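/- Let $(g,k)$ be an initial data set on an end $\{x\in\mathbb R^3:|x|>R\}$ with harmonic asymptotics, i.e. there are $C^2$ functions $u>0$ and $Y_1,Y_2,Y_3$ on the end, with $u\to1$ and $Y_i\to0$ at infinity, such that $$g_{ij}=u^4\delta_{ij},\qquad k_{ij}=u^2\Big(\partial_jY_i+\partial_iY_j-\tfrac12\Big(\sum_l\partial_lY_l\Big)\delta_{ij}\Big).$$ Suppose that $(g,k)$ satisfies the vacuum constraint equations $$R(g)+(\mathrm{tr}_g k)^2-|k|_g^2=0,\qquad \mathrm{div}_g\big(k-(\mathrm{tr}_g k)g\big)=0$$ (where $R(g)$ is the scalar curvature), and that, with $r=|x|$, as $r\to\infty$ and uniformly in the angular variable $\tilde X=x/r\in S^2$, $$u=1+\frac{A}{r}+\frac{u^{(-2)}(\tilde X)}{r^2}+o(r^{-2}),\qquad Y_i=\frac{B_i}{r}+\frac{Y_i^{(-2)}(\tilde X)}{r^2}+o(r^{-2}),$$ where $A,B_1,B_2,B_3$ are constants and $u^{(-2)},Y_i^{(-2)}$ are functions on $S^2$. Then there are constants $c_i$ and $d_{ij}$ $(1\le i,j\le3)$ such that, on $S^2$,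 $$u^{(-2)}=\sum_i c_i\tilde X^i-\frac{9}{64}\sum_i B_i^2+\frac1{64}\sum_{i,j}B_iB_j\tilde X^i\tilde X^j,$$ $$Y_i^{(-2)}=\sum_j d_{ij}\tilde X^j+A\Big(-\frac52B_i+\frac12\Big(\sum_kB_k\tilde X^k\Big)\tilde X^i\Big)\qquad(i=1,2,3),$$ where $\tilde X^1,\tilde X^2,\tilde X^3$ are the coordinate functions on $S^2\subset\mathbb R^3$. -/

import Mathlib

open Filter Topology Asymptotics Bornology

namespace InitialData

/-- Flat `ℝ³` with its Euclidean norm; `‖x‖` is the radial coordinate `r`. -/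
abbrev E3 : Type := EuclideanSpace ℝ (Fin 3)

/-- The complement of a closed ball: the asymptotic coordinate chart of an end. -/
def exterior (R : ℝ) : Set E3 := {x | R < ‖x‖}

/-- The partial derivative `∂_i f` in the coordinates of the end. -/
noncomputable def pd (i : Fin 3) (f : E3 → ℝ) (x : E3) : ℝ :=
  fderiv ℝ f x (EuclideanSpace.single i 1)

/-- The coordinate components of a covariant 2-tensor field. -/
abbrev Tensor2 : Type := E3 → Matrix (Fin 3) (Fin 3) ℝ

/-- Christoffel symbols
`Γ^l_{ij} = ½ g^{lm} (∂_i g_{mj} + ∂_j g_{mi} - ∂_m g_{ij})` of the metric `g`. -/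
noncomputable def christoffel (g : Tensor2) (l i j : Fin 3) (x : E3) : ℝ :=
  (1 / 2) * ∑ m, (g x)⁻¹ l m *
    (pd i (fun y => g y m j) x + pd j (fun y => g y m i) x - pd m (fun y => g y i j) x)

/-- Ricci curvature
`R_{ij} = ∂_l Γ^l_{ij} - ∂_j Γ^l_{il} + Γ^l_{lm} Γ^m_{ij} - Γ^l_{jm} Γ^m_{il}`. -/
noncomputable def ricci (g : Tensor2) (i j : Fin 3) (x : E3) : ℝ :=
  ∑ l, (pd l (christoffel g l i j) x - pd j (christoffel g l i l) x)
    + ∑ l, ∑ m, (christoffel g l l m x * christoffel g m i j x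
        - christoffel g l j m x * christoffel g m i l x)

/-- Scalar curvature `R(g) = g^{ij} R_{ij}`. -/
noncomputable def scalarCurvature (g : Tensor2) (x : E3) : ℝ :=
  ∑ i, ∑ j, (g x)⁻¹ i j * ricci g i j x

/-- The trace `tr_g T = g^{ij} T_{ij}`. -/
noncomputable def trace (g T : Tensor2) (x : E3) : ℝ :=
  ∑ i, ∑ j, (g x)⁻¹ i j * T x i j

/-- The squared norm `|T|_g² = g^{ia} g^{jb} T_{ij} T_{ab}`. -/
noncomputable def normSq (g T : Tensor2) (x : E3) : ℝ :=
  ∑ i, ∑ j, ∑ a, ∑ b, (g x)⁻¹ i a * (g x)⁻¹ j b * T x i j * T x a b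

/-- The covariant derivative `∇_m T_{ij} = ∂_m T_{ij} - Γ^l_{mi} T_{lj} - Γ^l_{mj} T_{il}`. -/
noncomputable def covDeriv (g T : Tensor2) (m i j : Fin 3) (x : E3) : ℝ :=
  pd m (fun y => T y i j) x
    - ∑ l, (christoffel g l m i x * T x l j + christoffel g l m j x * T x i l)

/-- The divergence `(div_g T)_j = g^{mi} ∇_m T_{ij}`. -/
noncomputable def divergence (g T : Tensor2) (j : Fin 3) (x : E3) : ℝ :=
  ∑ m, ∑ i, (g x)⁻¹ m i * covDeriv g T m i j x

/-- The vacuum constraint equations on a set `U`: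
`R(g) + (tr_g k)² - |k|_g² = 0` and `div_g (k - (tr_g k) g) = 0`. -/
def VacuumConstraint (g k : Tensor2) (U : Set E3) : Prop :=
  ∀ x ∈ U,
    scalarCurvature g x + (trace g k x) ^ 2 - normSq g k x = 0 ∧
    ∀ j, divergence g (fun y => k y - trace g k y • g y) j x = 0

/-- Harmonic asymptotics on an end: `g_{ij} = u⁴ δ_{ij}` and
`k_{ij} = u² (Y_{i,j} + Y_{j,i} - ½ Y_{k,k} δ_{ij})`, where `u` tends to `1` and `Y` tends to `0`
at infinity. No decay of derivatives of `u` and `Y` is required. -/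
structure HarmonicAsymptotics (R : ℝ) (g k : Tensor2) (u : E3 → ℝ) (Y : Fin 3 → E3 → ℝ) :
    Prop where
  contDiff_u : ContDiffOn ℝ 2 u (exterior R)
  contDiff_Y : ∀ i, ContDiffOn ℝ 2 (Y i) (exterior R)
  u_pos : ∀ x ∈ exterior R, 0 < u x
  metric_eq : ∀ x ∈ exterior R, ∀ i j, g x i j = u x ^ 4 * (if i = j then 1 else 0)
  k_eq : ∀ x ∈ exterior R, ∀ i j, k x i j =
    u x ^ 2 * (pd j (Y i) x + pd i (Y j) x - (∑ l, pd l (Y l) x) / 2 * (if i = j then 1 else 0))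
  u_tendsto : Tendsto u (cobounded E3) (𝓝 1)
  Y_tendsto : ∀ i, Tendsto (Y i) (cobounded E3) (𝓝 0)

/-- The expansion `f = a₀ + a₁ / r + f₂ / r² + o(r⁻²)` as `r → ∞`, uniformly in the angular
variable `x / r ∈ S²`, with constants `a₀`, `a₁` and a function `f₂` on the unit sphere
(only the values of `f₂` at unit vectors matter). -/
def HasExpansion (f : E3 → ℝ) (a₀ a₁ : ℝ) (f₂ : E3 → ℝ) : Prop :=
  (fun x => f x - (a₀ + a₁ / ‖x‖ + f₂ (‖x‖⁻¹ • x) / ‖x‖ ^ 2))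
    =o[cobounded E3] (fun x => 1 / ‖x‖ ^ 2)

end InitialData

namespace InitialData

/-! For `g = u⁴δ` one has `R(g) = -8u⁻⁵Δu`, and `k - (tr k)g` is `u²` times a tensor whose flat
divergence is `ΔY`. The constraints therefore read `Δu = u q₀(∇u, ∇Y)` and `ΔY_j = u⁻¹ q_j(∇u, ∇Y)`
with quadratic forms `q` (`lap_u`, `lap_Y`, `source`). Formally, if `F` denotes the second-order
coefficients, then `F(x/r)/r²` has flat Laplacian `q(∇(A/r), ∇(B/r))`, which is homogeneous of
degree `-4`. The explicit quadratic expressions solve this equation (`particular_spec`). The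
difference `h` makes `h(x/r)/r²` harmonic, that is `(Δ_{S²} + 2)h = 0`, so `h` is a first-order
spherical harmonic.

Two things have to be justified. First, nothing is assumed about the derivatives of the remainders.
Put `v_ρ(x) = ρ(f(ρx) - a₀) - a₁/|x|`; then `v_ρ = O(1/ρ)` and `ρ v_ρ → F(x/r)/r²` uniformly on `|x|
≥ 1`. The equations make `Δv_ρ` small compared with `1 + |∇v_ρ|²`, so Caccioppoli's inequality
(`integral_mul_gradSq_le`) bounds the local Dirichlet energy by `O(ρ⁻²)`. Hence the nonlinear error
disappears against test functions and the limit equation holds in the sense of distributions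
(`tendsto_integral_lap`, `integral_second_order`).

Second, `F` is merely continuous on the sphere, as a uniform limit, so rigidity has to be proved
weakly (`WeaklyHarmonic.exists_linear`). Testing with a radial bump times `r p(x·e/r)` shows that
`h` is orthogonal to `(Δ_{S²} + 2)p(θ·e)`. For `p(t) = t log(1+ε-t) + 1` this produces a kernel
concentrating at `e`, minus `3t`. Letting `ε → 0` and comparing with the known solution `θ·e` gives
`∫ h(θ)(θ·e) = h(e) ∫ (θ·e)²`. The last integral does not depend on `e`, and the left side is linear
in `e`; hence so is `h`. -/

/-- The flat Laplacian. -/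
noncomputable def lap (f : E3 → ℝ) (x : E3) : ℝ := ∑ i, pd i (pd i f) x

/-! ### Coordinate calculus: product, chain and scaling rules for `pd` and `lap`. -/

section Calculus

variable {f g : E3 → ℝ} {x : E3} {i j : Fin 3}

theorem pd_congr (h : f =ᶠ[𝓝 x] g) : pd i f x = pd i g x := by
  unfold pd; rw [h.fderiv_eq]

theorem pd_eventuallyEq (h : f =ᶠ[𝓝 x] g) : pd i f =ᶠ[𝓝 x] pd i g := by
  filter_upwards [h.eventuallyEq_nhds] with y hy using pd_congr hy

theorem lap_congr (h : f =ᶠ[𝓝 x] g) : lap f x = lap g x := by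
  unfold lap
  exact Finset.sum_congr rfl fun i _ => pd_congr (pd_eventuallyEq h)

theorem pd_const (c : ℝ) : pd i (fun _ => c) x = 0 := by
  simp [pd]

theorem pd_add (hf : DifferentiableAt ℝ f x) (hg : DifferentiableAt ℝ g x) :
    pd i (fun y => f y + g y) x = pd i f x + pd i g x := by
  unfold pd; rw [fderiv_fun_add hf hg]; rfl

theorem pd_sub (hf : DifferentiableAt ℝ f x) (hg : DifferentiableAt ℝ g x) :
    pd i (fun y => f y - g y) x = pd i f x - pd i g x := by
  unfold pd; rw [fderiv_fun_sub hf hg]; rfl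

theorem pd_sum {ι : Type*} {s : Finset ι} {F : ι → E3 → ℝ}
    (h : ∀ a ∈ s, DifferentiableAt ℝ (F a) x) :
    pd i (fun y => ∑ a ∈ s, F a y) x = ∑ a ∈ s, pd i (F a) x := by
  unfold pd; rw [fderiv_fun_sum h]; simp

theorem pd_mul (hf : DifferentiableAt ℝ f x) (hg : DifferentiableAt ℝ g x) :
    pd i (fun y => f y * g y) x = f x * pd i g x + g x * pd i f x := by
  unfold pd; rw [fderiv_fun_mul hf hg]; simp

theorem pd_const_mul (c : ℝ) : pd i (fun y => c * f y) x = c * pd i f x := by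
  unfold pd
  have : (fun y => c * f y) = c • f := rfl
  rw [this, fderiv_const_smul_field]; rfl

theorem pd_comp {p : ℝ → ℝ} (hp : DifferentiableAt ℝ p (f x)) (hf : DifferentiableAt ℝ f x) :
    pd i (fun y => p (f y)) x = deriv p (f x) * pd i f x := by
  unfold pd
  have := (hp.hasDerivAt.comp_hasFDerivAt x hf.hasFDerivAt).fderiv
  simp only [Function.comp_def] at this
  rw [this]; simp

theorem pd_comp_smul (c : ℝ) : pd i (fun y => f (c • y)) x = c * pd i f (c • x) := by
  unfold pd
  have := fderiv_comp_smul (𝕜 := ℝ) (f := f) (x := x) c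
  rw [this]; rfl

theorem lap_comp_smul (c : ℝ) : lap (fun y => f (c • y)) x = c ^ 2 * lap f (c • x) := by
  unfold lap
  rw [Finset.mul_sum]
  refine Finset.sum_congr rfl fun i _ => ?_
  have : pd i (fun y => f (c • y)) = fun y => c * pd i f (c • y) := by
    ext y; exact pd_comp_smul c
  rw [this, pd_const_mul, pd_comp_smul]; ring

theorem contDiffAt_pd {n m : WithTop ℕ∞} (hf : ContDiffAt ℝ n f x) (h : m + 1 ≤ n) :
    ContDiffAt ℝ m (pd i f) x := by
  unfold pd
  exact (hf.fderiv_right h).clm_apply contDiffAt_const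

theorem differentiableAt_pd (hf : ContDiffAt ℝ 2 f x) : DifferentiableAt ℝ (pd i f) x :=
  (contDiffAt_pd (m := 1) hf (by norm_num)).differentiableAt one_ne_zero

theorem eventually_differentiableAt (hf : ContDiffAt ℝ 2 f x) :
    ∀ᶠ y in 𝓝 x, DifferentiableAt ℝ f y := by
  filter_upwards [hf.eventually (by simp)] with y hy using hy.differentiableAt two_ne_zero

theorem pd_comm (hf : ContDiffAt ℝ 2 f x) : pd i (pd j f) x = pd j (pd i f) x := by
  have hs := hf.isSymmSndFDerivAt (by simp)
  have hd : DifferentiableAt ℝ (fderiv ℝ f) x :=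
    (hf.fderiv_right (m := 1) (by norm_num)).differentiableAt one_ne_zero
  have key : ∀ a b : Fin 3, pd a (pd b f) x
      = fderiv ℝ (fderiv ℝ f) x (EuclideanSpace.single a 1) (EuclideanSpace.single b 1) := by
    intro a b
    unfold pd
    rw [fderiv_clm_apply hd (differentiableAt_const _)]
    simp
  rw [key, key]
  exact hs _ _

theorem lap_add (hf : ContDiffAt ℝ 2 f x) (hg : ContDiffAt ℝ 2 g x) :
    lap (fun y => f y + g y) x = lap f x + lap g x := by
  unfold lap
  rw [← Finset.sum_add_distrib]
  refine Finset.sum_congr rfl fun i _ => ?_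
  rw [← pd_add (differentiableAt_pd hf) (differentiableAt_pd hg)]
  refine pd_congr ?_
  filter_upwards [eventually_differentiableAt hf, eventually_differentiableAt hg] with y h1 h2
    using pd_add h1 h2

theorem lap_const_mul (c : ℝ) : lap (fun y => c * f y) x = c * lap f x := by
  unfold lap
  rw [Finset.mul_sum]
  refine Finset.sum_congr rfl fun i _ => ?_
  have : pd i (fun y => c * f y) = fun y => c * pd i f y := by
    ext y; exact pd_const_mul c
  rw [this, pd_const_mul]

theorem lap_sub (hf : ContDiffAt ℝ 2 f x) (hg : ContDiffAt ℝ 2 g x) :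
    lap (fun y => f y - g y) x = lap f x - lap g x := by
  have h : (fun y => f y - g y) = fun y => f y + (-1) * g y := by ext; ring
  rw [h, lap_add hf (contDiffAt_const.mul hg), lap_const_mul]; ring

theorem lap_const (c : ℝ) : lap (fun _ => c) x = 0 := by
  have : ∀ i, pd i (fun _ : E3 => c) = fun _ => 0 := fun i => by ext; exact pd_const c
  simp [lap, this, pd_const]

theorem lap_mul (hf : ContDiffAt ℝ 2 f x) (hg : ContDiffAt ℝ 2 g x) :
    lap (fun y => f y * g y) x
      = f x * lap g x + 2 * ∑ i, pd i f x * pd i g x + g x * lap f x := by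
  unfold lap
  rw [Finset.mul_sum, Finset.mul_sum, Finset.mul_sum, ← Finset.sum_add_distrib,
    ← Finset.sum_add_distrib]
  refine Finset.sum_congr rfl fun i _ => ?_
  have h : pd i (fun y => f y * g y) =ᶠ[𝓝 x] fun y => f y * pd i g y + g y * pd i f y := by
    filter_upwards [eventually_differentiableAt hf, eventually_differentiableAt hg] with y h1 h2
      using pd_mul h1 h2
  have hf1 := hf.differentiableAt two_ne_zero
  have hg1 := hg.differentiableAt two_ne_zero
  rw [pd_congr h, pd_add (hf1.fun_mul (differentiableAt_pd hg)) (hg1.fun_mul (differentiableAt_pd hf)),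
    pd_mul hf1 (differentiableAt_pd hg), pd_mul hg1 (differentiableAt_pd hf)]
  ring

theorem lap_comp {p : ℝ → ℝ} (hp : ContDiffAt ℝ 2 p (f x)) (hf : ContDiffAt ℝ 2 f x) :
    lap (fun y => p (f y)) x
      = deriv (deriv p) (f x) * ∑ i, pd i f x ^ 2 + deriv p (f x) * lap f x := by
  unfold lap
  rw [Finset.mul_sum, Finset.mul_sum, ← Finset.sum_add_distrib]
  refine Finset.sum_congr rfl fun i _ => ?_
  have hp1 : ∀ᶠ t in 𝓝 (f x), DifferentiableAt ℝ p t := by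
    filter_upwards [hp.eventually (by simp)] with y hy using hy.differentiableAt two_ne_zero
  have hd : DifferentiableAt ℝ (deriv p) (f x) := by
    have : ContDiffAt ℝ 1 (deriv p) (f x) := by
      have h1 := (hp.fderiv_right (m := 1) (by norm_num)).clm_apply
        (contDiffAt_const (c := (1 : ℝ)))
      exact h1
    exact this.differentiableAt one_ne_zero
  have h : pd i (fun y => p (f y)) =ᶠ[𝓝 x] fun y => deriv p (f y) * pd i f y := by
    filter_upwards [eventually_differentiableAt hf, hf.continuousAt.eventually hp1] with y h1 h2
      using pd_comp h2 h1
  have hf1 := hf.differentiableAt two_ne_zero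
  rw [pd_congr h, pd_mul (f := fun y => deriv p (f y)) (hd.comp x hf1) (differentiableAt_pd hf),
    pd_comp hd hf1]
  ring

theorem pd_coord : pd i (fun y : E3 => y j) x = if i = j then 1 else 0 := by
  unfold pd
  have : (fun y : E3 => y j) = (EuclideanSpace.proj j : E3 →L[ℝ] ℝ) := rfl
  rw [this, ContinuousLinearMap.fderiv]
  simp [eq_comm]

theorem contDiff_coord {n : WithTop ℕ∞} : ContDiff ℝ n (fun y : E3 => y j) :=
  (EuclideanSpace.proj j : E3 →L[ℝ] ℝ).contDiff

theorem contDiff_inner_left {n : WithTop ℕ∞} (e : Fin 3 → ℝ) :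
    ContDiff ℝ n (fun y : E3 => ∑ j, e j * y j) :=
  ContDiff.sum fun _ _ => contDiff_const.mul contDiff_coord

theorem pd_linear (e : Fin 3 → ℝ) : pd i (fun y : E3 => ∑ j, e j * y j) x = e i := by
  rw [pd_sum fun a _ => (contDiff_const.mul contDiff_coord).differentiable one_ne_zero x]
  simp [pd_const_mul, pd_coord]

theorem lap_linear (e : Fin 3 → ℝ) : lap (fun y : E3 => ∑ j, e j * y j) x = 0 := by
  have : ∀ i, pd i (fun y : E3 => ∑ j, e j * y j) = fun _ => e i := fun i => by
    ext; exact pd_linear e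
  simp [lap, this, pd_const]

theorem norm_sq_eq_sum (x : E3) : ‖x‖ ^ 2 = ∑ i, x i ^ 2 := by
  rw [EuclideanSpace.norm_sq_eq]; simp

theorem contDiff_normSq {n : WithTop ℕ∞} : ContDiff ℝ n (fun y : E3 => ‖y‖ ^ 2) :=
  contDiff_norm_sq ℝ

theorem pd_normSq : pd i (fun y : E3 => ‖y‖ ^ 2) x = 2 * x i := by
  have : (fun y : E3 => ‖y‖ ^ 2) = fun y => ∑ j, y j * y j := by
    ext y; rw [norm_sq_eq_sum]; simp [sq]
  have hd : ∀ j, DifferentiableAt ℝ (fun y : E3 => y j) x :=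
    fun j => contDiff_coord.differentiable one_ne_zero x
  rw [this, pd_sum fun a _ => (hd a).fun_mul (hd a)]
  simp only [pd_mul (hd _) (hd _), pd_coord]
  simp [two_mul, Finset.sum_add_distrib]

theorem lap_normSq : lap (fun y : E3 => ‖y‖ ^ 2) x = 6 := by
  have : ∀ i, pd i (fun y : E3 => ‖y‖ ^ 2) = fun y => 2 * y i := fun i => by
    ext; exact pd_normSq
  simp [lap, this, pd_const_mul, pd_coord]; norm_num

/-- The gradient of a function of `‖y‖²`. -/
theorem pd_radial {p : ℝ → ℝ} (hp : DifferentiableAt ℝ p (‖x‖ ^ 2)) :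
    pd i (fun y : E3 => p (‖y‖ ^ 2)) x = 2 * deriv p (‖x‖ ^ 2) * x i := by
  rw [pd_comp (f := fun y : E3 => ‖y‖ ^ 2) hp (contDiff_normSq.differentiable one_ne_zero x),
    pd_normSq]; ring

theorem lap_radial {p : ℝ → ℝ} (hp : ContDiffAt ℝ 2 p (‖x‖ ^ 2)) :
    lap (fun y : E3 => p (‖y‖ ^ 2)) x
      = 4 * ‖x‖ ^ 2 * deriv (deriv p) (‖x‖ ^ 2) + 6 * deriv p (‖x‖ ^ 2) := by
  rw [lap_comp (f := fun y : E3 => ‖y‖ ^ 2) hp contDiff_normSq.contDiffAt, lap_normSq]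
  simp only [pd_normSq, mul_pow, ← Finset.mul_sum, ← norm_sq_eq_sum]
  ring

end Calculus

/-! ### Curvature of a conformally flat metric. -/

theorem isOpen_exterior (R : ℝ) : IsOpen (exterior R) :=
  isOpen_lt continuous_const continuous_norm

section Conformal

variable {g : Tensor2} {u : E3 → ℝ} {U : Set E3}

theorem conformal_inv {x : E3} (hux : 0 < u x)
    (hg : ∀ i j, g x i j = u x ^ 4 * (if i = j then 1 else 0)) (i j : Fin 3) :
    (g x)⁻¹ i j = (u x ^ 4)⁻¹ * (if i = j then 1 else 0) := by
  have h1 : g x = (u x ^ 4) • (1 : Matrix (Fin 3) (Fin 3) ℝ) := by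
    ext a b; rw [hg]; simp [Matrix.one_apply]
  have h2 : (g x)⁻¹ = (u x ^ 4)⁻¹ • (1 : Matrix (Fin 3) (Fin 3) ℝ) := by
    apply Matrix.inv_eq_left_inv
    rw [h1]
    have : u x ^ 4 ≠ 0 := by positivity
    simp [smul_smul, this]
  rw [h2]; simp [Matrix.one_apply]

theorem conformal_pd (hU : IsOpen U) (hu : ContDiffOn ℝ 2 u U)
    (hg : ∀ x ∈ U, ∀ i j, g x i j = u x ^ 4 * (if i = j then 1 else 0))
    {x : E3} (hx : x ∈ U) (m i j : Fin 3) :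
    pd m (fun y => g y i j) x = 4 * u x ^ 3 * pd m u x * (if i = j then 1 else 0) := by
  have h : (fun y => g y i j) =ᶠ[𝓝 x] fun y => (if i = j then 1 else 0) * (u y) ^ 4 := by
    filter_upwards [hU.mem_nhds hx] with y hy
    rw [hg y hy, mul_comm]
  have hd : DifferentiableAt ℝ u x := (hu.contDiffAt (hU.mem_nhds hx)).differentiableAt two_ne_zero
  rw [pd_congr h, pd_const_mul, pd_comp (p := fun t => t ^ 4) (by fun_prop) hd]
  simp

theorem conformal_christoffel (hU : IsOpen U) (hu : ContDiffOn ℝ 2 u U) (hpos : ∀ x ∈ U, 0 < u x)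
    (hg : ∀ x ∈ U, ∀ i j, g x i j = u x ^ 4 * (if i = j then 1 else 0))
    {x : E3} (hx : x ∈ U) (l i j : Fin 3) :
    christoffel g l i j x = 2 * ((u x)⁻¹ * ((if l = j then 1 else 0) * pd i u x
      + (if l = i then 1 else 0) * pd j u x - (if i = j then 1 else 0) * pd l u x)) := by
  have h0 := (hpos x hx).ne'
  unfold christoffel
  simp only [conformal_inv (hpos x hx) (hg x hx), conformal_pd hU hu hg hx]
  simp only [mul_ite, ite_mul, mul_one, mul_zero, zero_mul, Finset.sum_ite_eq, Finset.mem_univ,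
    if_true]
  split_ifs <;> field_simp <;> ring

theorem pd_inv_mul_pd {x : E3} (hu : ContDiffAt ℝ 2 u x) (h0 : u x ≠ 0) (i j : Fin 3) :
    pd i (fun y => (u y)⁻¹ * pd j u y) x
      = (u x)⁻¹ * pd i (pd j u) x - (u x)⁻¹ ^ 2 * pd i u x * pd j u x := by
  have hd := hu.differentiableAt two_ne_zero
  rw [pd_mul (f := fun y => (u y)⁻¹) (hd.inv h0) (differentiableAt_pd hu),
    pd_comp (p := fun t => t⁻¹) (differentiableAt_inv h0) hd, deriv_inv]
  field_simp
  ring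

theorem conformal_pd_christoffel (hU : IsOpen U) (hu : ContDiffOn ℝ 2 u U)
    (hpos : ∀ x ∈ U, 0 < u x)
    (hg : ∀ x ∈ U, ∀ i j, g x i j = u x ^ 4 * (if i = j then 1 else 0))
    {x : E3} (hx : x ∈ U) (m l i j : Fin 3) :
    pd m (christoffel g l i j) x =
      2 * ((if l = j then 1 else 0) *
          ((u x)⁻¹ * pd m (pd i u) x - (u x)⁻¹ ^ 2 * pd m u x * pd i u x)
        + (if l = i then 1 else 0) *
          ((u x)⁻¹ * pd m (pd j u) x - (u x)⁻¹ ^ 2 * pd m u x * pd j u x)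
        - (if i = j then 1 else 0) *
          ((u x)⁻¹ * pd m (pd l u) x - (u x)⁻¹ ^ 2 * pd m u x * pd l u x)) := by
  have hc := hu.contDiffAt (hU.mem_nhds hx)
  have h0 := (hpos x hx).ne'
  have h : christoffel g l i j =ᶠ[𝓝 x] fun y => 2 * (((if l = j then 1 else 0) *
      ((u y)⁻¹ * pd i u y) + (if l = i then 1 else 0) * ((u y)⁻¹ * pd j u y))
      - (if i = j then 1 else 0) * ((u y)⁻¹ * pd l u y)) := by
    filter_upwards [hU.mem_nhds hx] with y hy
    rw [conformal_christoffel hU hu hpos hg hy]; ring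
  have hd : ∀ a, DifferentiableAt ℝ (fun y => (u y)⁻¹ * pd a u y) x := fun a =>
    ((hc.differentiableAt two_ne_zero).fun_inv h0).fun_mul (differentiableAt_pd hc)
  have hdc : ∀ (c : ℝ) a, DifferentiableAt ℝ (fun y => c * ((u y)⁻¹ * pd a u y)) x := fun c a =>
    (differentiableAt_const c).fun_mul (hd a)
  rw [pd_congr h, pd_const_mul, pd_sub ((hdc _ _).fun_add (hdc _ _)) (hdc _ _),
    pd_add (hdc _ _) (hdc _ _)]
  simp only [pd_const_mul, pd_inv_mul_pd hc h0]

theorem conformal_scalarCurvature (hU : IsOpen U) (hu : ContDiffOn ℝ 2 u U)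
    (hpos : ∀ x ∈ U, 0 < u x)
    (hg : ∀ x ∈ U, ∀ i j, g x i j = u x ^ 4 * (if i = j then 1 else 0))
    {x : E3} (hx : x ∈ U) :
    scalarCurvature g x = -8 * (u x ^ 5)⁻¹ * lap u x := by
  have h0 := (hpos x hx).ne'
  unfold scalarCurvature ricci
  simp only [conformal_inv (hpos x hx) (hg x hx), conformal_christoffel hU hu hpos hg hx,
    conformal_pd_christoffel hU hu hpos hg hx, lap]
  simp only [Fin.sum_univ_three, Fin.isValue, if_true, Fin.reduceEq, if_false, mul_one, mul_zero,
    zero_mul, one_mul, add_zero, zero_add, sub_zero, zero_sub]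
  field_simp
  ring

end Conformal

/-! ### Reduction of the constraints to a semilinear elliptic system. -/

/-- The right-hand sides of the reduced constraint equations as quadratic forms in the gradients
of `u` (index `none`) and `Y i` (index `some i`). -/
noncomputable def source (D : Option (Fin 3) → Fin 3 → ℝ) : Option (Fin 3) → ℝ
  | none => 1 / 8 * (1 / 4 * (∑ l, D (some l) l) ^ 2 - ∑ i, ∑ j,
      (D (some i) j + D (some j) i - (∑ l, D (some l) l) / 2 * (if i = j then 1 else 0)) ^ 2)
  | some j => -4 * ∑ m, D none m * (D (some m) j + D (some j) m
      - (∑ l, D (some l) l) * (if m = j then 1 else 0)) - 2 * D none j * ∑ l, D (some l) l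

/-- The unknowns `u`, `Y` as one family. -/
def unknown (u : E3 → ℝ) (Y : Fin 3 → E3 → ℝ) : Option (Fin 3) → E3 → ℝ
  | none => u
  | some i => Y i

variable {R : ℝ} {g k : Tensor2} {u : E3 → ℝ} {Y : Fin 3 → E3 → ℝ}

theorem HarmonicAsymptotics.lap_u (h : HarmonicAsymptotics R g k u Y)
    (hV : VacuumConstraint g k (exterior R)) {x : E3} (hx : x ∈ exterior R) :
    lap u x = u x * source (fun a i => pd i (unknown u Y a) x) none := by
  have h0 := (h.u_pos x hx).ne'
  have hS := (hV x hx).1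
  rw [conformal_scalarCurvature (isOpen_exterior R) h.contDiff_u h.u_pos h.metric_eq hx] at hS
  unfold trace normSq at hS
  simp only [conformal_inv (h.u_pos x hx) (h.metric_eq x hx), h.k_eq x hx] at hS
  simp only [source, unknown]
  simp only [Fin.sum_univ_three, Fin.isValue, if_true, Fin.reduceEq, if_false, mul_one, mul_zero,
    zero_mul, add_zero, zero_add, sub_zero] at hS ⊢
  field_simp at hS
  linear_combination (-1 / 32) * hS

theorem HarmonicAsymptotics.trace_k (h : HarmonicAsymptotics R g k u Y)
    {x : E3} (hx : x ∈ exterior R) :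
    trace g k x = (u x ^ 2)⁻¹ * ((∑ l, pd l (Y l) x) / 2) := by
  have h0 := (h.u_pos x hx).ne'
  unfold trace
  simp only [conformal_inv (h.u_pos x hx) (h.metric_eq x hx), h.k_eq x hx]
  simp only [Fin.sum_univ_three, Fin.isValue, if_true, Fin.reduceEq, if_false, mul_one, mul_zero,
    zero_mul, add_zero, zero_add, sub_zero]
  field_simp
  ring

/-- Subtracting the trace changes the coefficient of `div Y` from `1/2` to `1`. With that
coefficient the flat divergence of the bracket is exactly `ΔY`, which is the point of the ansatz for
`k`. -/
theorem HarmonicAsymptotics.momentum_eq (h : HarmonicAsymptotics R g k u Y)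
    {x : E3} (hx : x ∈ exterior R) (i j : Fin 3) :
    (k x - trace g k x • g x) i j = u x ^ 2 *
      (pd j (Y i) x + pd i (Y j) x - (∑ l, pd l (Y l) x) * (if i = j then 1 else 0)) := by
  have h0 := (h.u_pos x hx).ne'
  rw [Matrix.sub_apply, Matrix.smul_apply, h.trace_k hx, h.k_eq x hx, h.metric_eq x hx,
    smul_eq_mul]
  field_simp
  ring

/-- In the divergence of the bracket the two `∂_j div Y` terms cancel once second derivatives
commute; the derivative of `u²` and the Christoffel symbols leave only products of first
derivatives. -/
theorem HarmonicAsymptotics.lap_Y (h : HarmonicAsymptotics R g k u Y)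
    (hV : VacuumConstraint g k (exterior R)) {x : E3} (hx : x ∈ exterior R) (j : Fin 3) :
    lap (Y j) x = (u x)⁻¹ * source (fun a i => pd i (unknown u Y a) x) (some j) := by
  have h0 := (h.u_pos x hx).ne'
  have hU := isOpen_exterior R
  have hS := (hV x hx).2 j
  have hu := h.contDiff_u.contDiffAt (hU.mem_nhds hx)
  have hY : ∀ i, ContDiffAt ℝ 2 (Y i) x := fun i => (h.contDiff_Y i).contDiffAt (hU.mem_nhds hx)
  have hpd : ∀ m a b, pd m (fun y => (k y - trace g k y • g y) a b) x
      = u x ^ 2 * (pd m (pd b (Y a)) x + pd m (pd a (Y b)) x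
        - (∑ l, pd m (pd l (Y l)) x) * (if a = b then 1 else 0))
        + 2 * u x * pd m u x * (pd b (Y a) x + pd a (Y b) x
          - (∑ l, pd l (Y l) x) * (if a = b then 1 else 0)) := by
    intro m a b
    have he : (fun y => (k y - trace g k y • g y) a b) =ᶠ[𝓝 x] fun y => u y ^ 2 *
        ((pd b (Y a) y + pd a (Y b) y) - (if a = b then 1 else 0) * (∑ l, pd l (Y l) y)) := by
      filter_upwards [hU.mem_nhds hx] with y hy
      rw [h.momentum_eq hy]; ring
    have hd1 : DifferentiableAt ℝ (fun y => pd b (Y a) y + pd a (Y b) y) x :=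
      (differentiableAt_pd (hY a)).fun_add (differentiableAt_pd (hY b))
    have hd2 : DifferentiableAt ℝ (fun y => ∑ l, pd l (Y l) y) x :=
      DifferentiableAt.fun_sum fun l _ => differentiableAt_pd (hY l)
    have hd3 : DifferentiableAt ℝ (fun y => (if a = b then 1 else 0) * (∑ l, pd l (Y l) y)) x :=
      (differentiableAt_const _).fun_mul hd2
    have hdu := hu.differentiableAt two_ne_zero
    rw [pd_congr he, pd_mul (hdu.fun_pow 2) (hd1.fun_sub hd3), pd_sub hd1 hd3,
      pd_add (differentiableAt_pd (hY a)) (differentiableAt_pd (hY b)), pd_const_mul,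
      pd_sum fun l _ => differentiableAt_pd (hY l),
      pd_comp (p := fun t => t ^ 2) (by fun_prop) hdu]
    simp
    ring
  have hcomm : ∀ m l, pd m (pd l (Y m)) x = pd l (pd m (Y m)) x := fun m l => pd_comm (hY m)
  unfold divergence covDeriv at hS
  simp only [hpd, h.momentum_eq hx, conformal_inv (h.u_pos x hx) (h.metric_eq x hx),
    conformal_christoffel hU h.contDiff_u h.u_pos h.metric_eq hx] at hS
  simp only [source, unknown, lap]
  fin_cases j <;>
  · simp only [Fin.sum_univ_three, Fin.isValue, if_true, Fin.reduceEq, if_false, mul_one, mul_zero,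
      zero_mul, one_mul, add_zero, zero_add, sub_zero, zero_sub, Fin.zero_eta, Fin.mk_one,
      Fin.reduceFinMk] at hS ⊢
    field_simp at hS ⊢
    -- Each rewrite moves the derivative matching the component of `Y` innermost, so both orders of
    -- indices can be used together without looping.
    have h01 := hcomm 0 1
    have h02 := hcomm 0 2
    have h10 := hcomm 1 0
    have h12 := hcomm 1 2
    have h20 := hcomm 2 0
    have h21 := hcomm 2 1
    simp only [h01, h02, h10, h12, h20, h21] at hS ⊢
    linear_combination hS

open MeasureTheory

/-! ### Integration by parts against compactly supported test functions. -/

section Green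

variable {φ g : E3 → ℝ} {U : Set E3}

theorem tsupport_pd_subset (i : Fin 3) : tsupport (pd i φ) ⊆ tsupport φ := by
  refine closure_minimal (fun x hx => ?_) (isClosed_tsupport φ)
  by_contra h
  refine hx ?_
  rw [pd_congr (notMem_tsupport_iff_eventuallyEq.1 h)]
  exact pd_const 0

theorem tsupport_lap_subset : tsupport (lap φ) ⊆ tsupport φ := by
  refine closure_minimal (fun x hx => ?_) (isClosed_tsupport φ)
  by_contra h
  refine hx ?_
  rw [lap_congr (notMem_tsupport_iff_eventuallyEq.1 h)]
  exact lap_const 0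

/-- Extension by zero: off `tsupport φ` the product vanishes in a neighbourhood, whatever values `g`
takes outside `U`. -/
theorem contDiff_mul_of_tsupport {n : WithTop ℕ∞} (hU : IsOpen U) (hφ : ContDiff ℝ n φ)
    (hsub : tsupport φ ⊆ U) (hg : ContDiffOn ℝ n g U) : ContDiff ℝ n fun x => φ x * g x := by
  rw [contDiff_iff_contDiffAt]
  intro x
  by_cases hx : x ∈ tsupport φ
  · exact hφ.contDiffAt.mul (hg.contDiffAt (hU.mem_nhds (hsub hx)))
  · refine (contDiffAt_const (c := (0 : ℝ))).congr_of_eventuallyEq ?_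
    filter_upwards [notMem_tsupport_iff_eventuallyEq.1 hx] with y hy
    simp [hy]

theorem integrable_mul_of_tsupport (hU : IsOpen U) (hφ : Continuous φ) (hs : HasCompactSupport φ)
    (hsub : tsupport φ ⊆ U) (hg : ContinuousOn g U) : Integrable fun x => φ x * g x := by
  rw [← contDiff_zero (𝕜 := ℝ)] at hφ
  rw [← contDiffOn_zero (𝕜 := ℝ)] at hg
  exact (contDiff_mul_of_tsupport hU hφ hsub hg).continuous.integrable_of_hasCompactSupport
    hs.mul_right

theorem contDiffOn_pd {n m : WithTop ℕ∞} (hU : IsOpen U) (hg : ContDiffOn ℝ n g U)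
    (h : m + 1 ≤ n) (i : Fin 3) : ContDiffOn ℝ m (pd i g) U := fun _ hx =>
  (contDiffAt_pd (hg.contDiffAt (hU.mem_nhds hx)) h).contDiffWithinAt

theorem continuousOn_lap (hU : IsOpen U) (hg : ContDiffOn ℝ 2 g U) : ContinuousOn (lap g) U := by
  unfold lap
  refine continuousOn_finsetSum _ fun i _ => ?_
  exact (contDiffOn_pd (m := 0) hU (contDiffOn_pd (m := 1) hU hg (by norm_num) i)
    (by norm_num) i).continuousOn

theorem continuous_lap (hg : ContDiff ℝ 2 g) : Continuous (lap g) :=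
  continuousOn_univ.1 (continuousOn_lap isOpen_univ hg.contDiffOn)

theorem integral_pd_eq_zero {F : E3 → ℝ} (hF : ContDiff ℝ 1 F) (hs : HasCompactSupport F)
    (i : Fin 3) : ∫ x, pd i F x = 0 := by
  have hc : Continuous (pd i F) :=
    continuousOn_univ.1
      (contDiffOn_pd (m := 0) isOpen_univ hF.contDiffOn (by norm_num) i).continuousOn
  have hi : Integrable (pd i F) :=
    hc.integrable_of_hasCompactSupport (hs.mono' (subset_closure.trans (tsupport_pd_subset i)))
  -- Integration by parts against the constant function `1`.
  have h := integral_mul_fderiv_eq_neg_fderiv_mul_of_integrable (μ := (volume : Measure E3))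
    (f := fun _ => (1 : ℝ)) (g := F) (v := EuclideanSpace.single i 1) (by simp)
    (by simpa using! hi) (by simpa using hF.continuous.integrable_of_hasCompactSupport hs)
    (by simp) (fun x _ => hF.differentiable one_ne_zero x)
  simpa [pd] using h

/-- Green's second identity. -/
theorem integral_mul_lap (hU : IsOpen U) (hφ : ContDiff ℝ 2 φ) (hs : HasCompactSupport φ)
    (hsub : tsupport φ ⊆ U) (hg : ContDiffOn ℝ 2 g U) :
    ∫ x, g x * lap φ x = ∫ x, φ x * lap g x := by
  have h1 : ∀ i, ContDiff ℝ 1 fun x => φ x * pd i g x := fun i =>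
    contDiff_mul_of_tsupport hU (hφ.of_le (by norm_num)) hsub
      (contDiffOn_pd hU hg (by norm_num) i)
  have hpd : ∀ i, ContDiff ℝ 1 (pd i φ) := fun i =>
    contDiffOn_univ.1 (contDiffOn_pd isOpen_univ hφ.contDiffOn (by norm_num) i)
  have h2 : ∀ i, ContDiff ℝ 1 fun x => pd i φ x * g x := fun i =>
    contDiff_mul_of_tsupport hU (hpd i)
      ((tsupport_pd_subset i).trans hsub) (hg.of_le (by norm_num))
  have hspd : ∀ i, HasCompactSupport (pd i φ) := fun i =>
    hs.mono' (subset_closure.trans (tsupport_pd_subset i))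
  have h3 : ∀ i, ∫ x, pd i (fun y => φ y * pd i g y - pd i φ y * g y) x = 0 := fun i =>
    integral_pd_eq_zero ((h1 i).sub (h2 i)) (hs.mul_right.sub (hspd i).mul_right) i
  -- The field `φ∇g - g∇φ` has divergence `φΔg - gΔφ`. Off `tsupport φ` the function `g` need not be
  -- differentiable, so both sides are shown to vanish there separately.
  have h4 : ∀ x, ∑ i, pd i (fun y => φ y * pd i g y - pd i φ y * g y) x
      = φ x * lap g x - lap φ x * g x := by
    intro x
    by_cases hx : x ∈ tsupport φ
    · have hgx := hg.contDiffAt (hU.mem_nhds (hsub hx))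
      have hgd := hgx.differentiableAt two_ne_zero
      have hφd := hφ.differentiable two_ne_zero x
      have hp : ∀ i, DifferentiableAt ℝ (pd i φ) x := fun i => differentiableAt_pd hφ.contDiffAt
      simp only [pd_sub ((h1 _).differentiable one_ne_zero x)
        ((h2 _).differentiable one_ne_zero x), pd_mul hφd (differentiableAt_pd hgx),
        pd_mul (hp _) hgd, lap, Finset.mul_sum, Finset.sum_mul, ← Finset.sum_sub_distrib]
      exact Finset.sum_congr rfl fun i _ => by ring
    · have hz := notMem_tsupport_iff_eventuallyEq.1 hx
      have hl : lap φ x = 0 := by rw [lap_congr hz]; exact lap_const 0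
      rw [hz.eq_of_nhds, hl]
      simp only [Pi.zero_apply, zero_mul, sub_zero]
      refine Finset.sum_eq_zero fun i _ => ?_
      have : (fun y => φ y * pd i g y - pd i φ y * g y) =ᶠ[𝓝 x] fun _ => 0 := by
        filter_upwards [hz, pd_eventuallyEq (i := i) hz] with y hy1 hy2
        rw [hy1, hy2, show pd i (0 : E3 → ℝ) y = 0 from pd_const 0]
        simp
      rw [pd_congr this, pd_const]
  have hI1 : Integrable fun x => φ x * lap g x :=
    integrable_mul_of_tsupport hU hφ.continuous hs hsub (continuousOn_lap hU hg)
  have hI2 : Integrable fun x => lap φ x * g x :=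
    integrable_mul_of_tsupport hU (continuous_lap hφ)
      (hs.mono' (subset_closure.trans tsupport_lap_subset)) (tsupport_lap_subset.trans hsub)
      hg.continuousOn
  have h5 : ∫ x, (φ x * lap g x - lap φ x * g x) = 0 := by
    simp only [← h4]
    rw [integral_finsetSum]
    · exact Finset.sum_eq_zero fun i _ => h3 i
    · intro i _
      have hF := (h1 i).sub (h2 i)
      have hsF : HasCompactSupport (fun y => φ y * pd i g y - pd i φ y * g y) :=
        hs.mul_right.sub (hspd i).mul_right
      have hc : Continuous (pd i (fun y => φ y * pd i g y - pd i φ y * g y)) :=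
        continuousOn_univ.1
          (contDiffOn_pd (m := 0) isOpen_univ hF.contDiffOn (by norm_num) i).continuousOn
      exact hc.integrable_of_hasCompactSupport
        (hsF.mono' (subset_closure.trans (tsupport_pd_subset i)))
  rw [integral_sub hI1 hI2, sub_eq_zero] at h5
  rw [h5]
  exact integral_congr_ae (ae_of_all _ fun x => mul_comm _ _)

end Green

/-! ### Energy estimate and passage to the limit in the nonlinear equation. -/

section Caccioppoli

variable {ι : Type*} [Fintype ι] {U : Set E3} {χ φ : E3 → ℝ}

/-- The squared norm of the gradient of a family of functions. -/
noncomputable def gradSq (v : ι → E3 → ℝ) (x : E3) : ℝ := ∑ a, ∑ i, pd i (v a) x ^ 2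

theorem gradSq_nonneg (v : ι → E3 → ℝ) (x : E3) : 0 ≤ gradSq v x :=
  Finset.sum_nonneg fun _ _ => Finset.sum_nonneg fun _ _ => sq_nonneg _

theorem continuousOn_gradSq (hU : IsOpen U) {v : ι → E3 → ℝ} (hv : ∀ a, ContDiffOn ℝ 2 (v a) U) :
    ContinuousOn (gradSq v) U :=
  continuousOn_finsetSum _ fun a _ => continuousOn_finsetSum _ fun i _ =>
    (contDiffOn_pd (m := 1) hU (hv a) (by norm_num) i).continuousOn.pow 2

/-- Caccioppoli's inequality for small solutions of an elliptic system with small quadratic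
gradient nonlinearity. -/
theorem integral_mul_gradSq_le (hU : IsOpen U) (hχ : ContDiff ℝ 2 χ) (hs : HasCompactSupport χ)
    (hsub : tsupport χ ⊆ U) (hχ0 : ∀ x, 0 ≤ χ x) {v : ι → E3 → ℝ}
    (hv : ∀ a, ContDiffOn ℝ 2 (v a) U) {δ : ℝ} (hδ0 : 0 ≤ δ)
    (hδ : Fintype.card ι * δ ^ 2 ≤ 1 / 2) (hvδ : ∀ a, ∀ x ∈ U, |v a x| ≤ δ)
    (hlap : ∀ a, ∀ x ∈ U, |lap (v a) x| ≤ δ * (gradSq v x + 1)) :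
    ∫ x, χ x * gradSq v x
      ≤ δ ^ 2 * (Fintype.card ι * ((∫ x, |lap χ x|) + 2 * ∫ x, χ x)) := by
  have hIS : Integrable fun x => χ x * gradSq v x :=
    integrable_mul_of_tsupport hU hχ.continuous hs hsub (continuousOn_gradSq hU hv)
  have hIχ : Integrable χ := hχ.continuous.integrable_of_hasCompactSupport hs
  have hsl : HasCompactSupport (lap χ) := hs.mono' (subset_closure.trans tsupport_lap_subset)
  have hIl : Integrable (lap χ) := (continuous_lap hχ).integrable_of_hasCompactSupport hsl
  have hIa : ∀ a, Integrable fun x => χ x * ∑ i, pd i (v a) x ^ 2 := fun a =>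
    integrable_mul_of_tsupport hU hχ.continuous hs hsub (continuousOn_finsetSum _ fun i _ =>
      (contDiffOn_pd (m := 1) hU (hv a) (by norm_num) i).continuousOn.pow 2)
  -- Integrate `Δ(v²) = 2|∇v|² + 2vΔv` against `χ`. Moving the Laplacian to `χ` costs `δ²∫|Δχ|`, and
  -- `|vΔv| ≤ δ²(|∇v|² + 1)`, with one factor `δ` from each hypothesis.
  have key : ∀ a, ∫ x, χ x * ∑ i, pd i (v a) x ^ 2 ≤
      δ ^ 2 * (1 / 2 * (∫ x, |lap χ x|) + (∫ x, χ x * gradSq v x) + ∫ x, χ x) := by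
    intro a
    have hsq : ContDiffOn ℝ 2 (fun x => v a x * v a x) U := (hv a).mul (hv a)
    have hG := integral_mul_lap hU hχ hs hsub hsq
    have hle : (fun x => χ x * lap (fun x => v a x * v a x) x) = fun x =>
        2 * (χ x * ∑ i, pd i (v a) x ^ 2) + 2 * (χ x * (v a x * lap (v a) x)) := by
      ext x
      by_cases hx : x ∈ tsupport χ
      · have := (hv a).contDiffAt (hU.mem_nhds (hsub hx))
        rw [lap_mul this this]
        simp only [← sq]
        ring
      · simp [image_eq_zero_of_notMem_tsupport hx]
    have hI2 : Integrable fun x => χ x * (v a x * lap (v a) x) :=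
      integrable_mul_of_tsupport hU hχ.continuous hs hsub
        ((hv a).continuousOn.mul (continuousOn_lap hU (hv a)))
    rw [hle, integral_add ((hIa a).const_mul 2) (hI2.const_mul 2), integral_const_mul,
      integral_const_mul] at hG
    have hI3 : Integrable fun x => v a x * v a x * lap χ x := by
      have := integrable_mul_of_tsupport hU (continuous_lap hχ) hsl
        (tsupport_lap_subset.trans hsub) hsq.continuousOn
      simpa only [mul_comm] using this
    have h1 : ∫ x, v a x * v a x * lap χ x ≤ δ ^ 2 * ∫ x, |lap χ x| := by
      rw [← integral_const_mul]
      refine integral_mono hI3 (hIl.abs.const_mul _) fun x => ?_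
      by_cases hx : x ∈ tsupport χ
      · have h := hvδ a x (hsub hx)
        have : v a x * v a x ≤ δ ^ 2 := by nlinarith [abs_nonneg (v a x), abs_mul_abs_self (v a x)]
        calc v a x * v a x * lap χ x ≤ |v a x * v a x * lap χ x| := le_abs_self _
          _ = v a x * v a x * |lap χ x| := by rw [abs_mul, abs_mul_self]
          _ ≤ _ := by gcongr
      · simp [image_eq_zero_of_notMem_tsupport fun h => hx (tsupport_lap_subset h)]
    have h2 : -∫ x, χ x * (v a x * lap (v a) x) ≤
        δ ^ 2 * ((∫ x, χ x * gradSq v x) + ∫ x, χ x) := by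
      rw [← integral_neg, ← integral_add hIS hIχ, ← integral_const_mul]
      refine integral_mono hI2.neg ((hIS.add hIχ).const_mul _) fun x => ?_
      by_cases hx : x ∈ tsupport χ
      · have h := hvδ a x (hsub hx)
        have h' := hlap a x (hsub hx)
        have : -(v a x * lap (v a) x) ≤ δ * (δ * (gradSq v x + 1)) := by
          calc -(v a x * lap (v a) x) ≤ |v a x * lap (v a) x| := neg_le_abs _
            _ = |v a x| * |lap (v a) x| := abs_mul _ _
            _ ≤ _ := by gcongr
        calc -(χ x * (v a x * lap (v a) x)) = χ x * -(v a x * lap (v a) x) := by ring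
          _ ≤ χ x * (δ * (δ * (gradSq v x + 1))) := mul_le_mul_of_nonneg_left this (hχ0 x)
          _ = _ := by ring
      · simp [image_eq_zero_of_notMem_tsupport hx]
    linarith
  have hsum : ∫ x, χ x * gradSq v x = ∑ a, ∫ x, χ x * ∑ i, pd i (v a) x ^ 2 := by
    rw [← integral_finsetSum _ fun a _ => hIa a]
    simp only [gradSq, Finset.mul_sum]
  have h6 := Finset.sum_le_sum fun a (_ : a ∈ Finset.univ) => key a
  rw [← hsum, Finset.sum_const, Finset.card_univ, nsmul_eq_mul] at h6
  have h7 : 0 ≤ ∫ x, χ x * gradSq v x :=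
    integral_nonneg fun x => mul_nonneg (hχ0 x) (gradSq_nonneg v x)
  -- Absorption: the energy on the right has coefficient `card ι * δ² ≤ 1/2`.
  nlinarith [mul_le_mul_of_nonneg_right hδ h7]

/-- The second-order coefficient of a family converging at rate `1/ρ` satisfies the limit
equation in the sense of distributions. -/
theorem tendsto_integral_lap (hU : IsOpen U) (hχ : ContDiff ℝ 2 χ) (hs : HasCompactSupport χ)
    (hsub : tsupport χ ⊆ U) (hχ0 : ∀ x, 0 ≤ χ x)
    (hφ : ContDiff ℝ 2 φ) (hsφ : HasCompactSupport φ) (hsubφ : tsupport φ ⊆ U)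
    {K : ℝ} (hφχ : ∀ x, |φ x| ≤ K * χ x)
    {v : ℝ → ι → E3 → ℝ} {Q : ι → E3 → ℝ} {C : ℝ} (hC : 0 ≤ C) {δ : ℝ → ℝ}
    (hδ : Tendsto δ atTop (𝓝 0)) (hQ : ∀ a, ContinuousOn (Q a) U)
    (hQC : ∀ a, ∀ x ∈ U, |Q a x| ≤ C)
    (hv : ∀ᶠ ρ in atTop, ∀ a, ContDiffOn ℝ 2 (v ρ a) U ∧ ∀ x ∈ U, |v ρ a x| ≤ C / ρ ∧
      |ρ * lap (v ρ a) x - Q a x| ≤ C * (gradSq (v ρ) x + √(gradSq (v ρ) x) + δ ρ)) (a : ι) :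
    Tendsto (fun ρ => ∫ x, ρ * v ρ a x * lap φ x) atTop (𝓝 (∫ x, φ x * Q a x)) := by
  have hIχ : Integrable χ := hχ.continuous.integrable_of_hasCompactSupport hs
  set M : ℝ := Fintype.card ι * ((∫ x, |lap χ x|) + 2 * ∫ x, χ x) with hM
  have hsmall : ∀ᶠ ρ : ℝ in atTop, (Fintype.card ι : ℝ) * (4 * C / ρ) ^ 2 ≤ 1 / 2 := by
    have : Tendsto (fun ρ : ℝ => (Fintype.card ι : ℝ) * (4 * C / ρ) ^ 2) atTop
        (𝓝 ((Fintype.card ι : ℝ) * 0 ^ 2)) :=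
      ((tendsto_const_nhds.div_atTop tendsto_id).pow 2).const_mul _
    exact this.eventually_le_const (by norm_num)
  have hδ1 : ∀ᶠ ρ in atTop, δ ρ ≤ 1 := hδ.eventually_le_const one_pos
  have hbound : ∀ᶠ ρ : ℝ in atTop, |(∫ x, ρ * v ρ a x * lap φ x) - ∫ x, φ x * Q a x| ≤
      C * ((1 / ρ ^ 2 + 1 / ρ) * ((4 * C) ^ 2 * (|K| * M))
        + (1 / ρ + |δ ρ|) * (|K| * ∫ x, χ x)) := by
    filter_upwards [hv, hsmall, hδ1, eventually_gt_atTop 0] with ρ hρ hsm hd hρ0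
    have hcv := fun a => (hρ a).1
    have hsqrt : ∀ x, √(gradSq (v ρ) x) ≤ gradSq (v ρ) x + 1 := fun x => by
      nlinarith [Real.sq_sqrt (gradSq_nonneg (v ρ) x), sq_nonneg (√(gradSq (v ρ) x) - 1)]
    -- With `S` the gradient square, `√S ≤ S + 1`, `δ ρ ≤ 1` and `|Q| ≤ C` give `|ρΔv| ≤ C(2S + 3)`;
    -- hence the factor `4C`.
    have hlap : ∀ a, ∀ x ∈ U, |lap (v ρ a) x| ≤ 4 * C / ρ * (gradSq (v ρ) x + 1) := by
      intro a x hx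
      have h1 := ((hρ a).2 x hx).2
      have h2 : |ρ * lap (v ρ a) x| ≤ 4 * C * (gradSq (v ρ) x + 1) := by
        calc |ρ * lap (v ρ a) x| = |(ρ * lap (v ρ a) x - Q a x) + Q a x| := by ring_nf
          _ ≤ |ρ * lap (v ρ a) x - Q a x| + |Q a x| := abs_add_le _ _
          _ ≤ C * (gradSq (v ρ) x + √(gradSq (v ρ) x) + δ ρ) + C := add_le_add h1 (hQC a x hx)
          _ ≤ C * (gradSq (v ρ) x + (gradSq (v ρ) x + 1) + 1) + C := by
              gcongr; exact hsqrt x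
          _ ≤ _ := by nlinarith [mul_nonneg hC (gradSq_nonneg (v ρ) x)]
      rw [abs_mul, abs_of_pos hρ0] at h2
      rw [div_mul_eq_mul_div, le_div_iff₀ hρ0]
      linarith
    have hcac := integral_mul_gradSq_le hU hχ hs hsub hχ0 hcv (δ := 4 * C / ρ) (by positivity) hsm
      (fun a x hx => (((hρ a).2 x hx).1).trans (by gcongr; linarith)) hlap
    rw [← hM] at hcac
    have hIS : Integrable fun x => χ x * gradSq (v ρ) x :=
      integrable_mul_of_tsupport hU hχ.continuous hs hsub (continuousOn_gradSq hU hcv)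
    have hI1 : Integrable fun x => φ x * (ρ * lap (v ρ a) x) :=
      integrable_mul_of_tsupport hU hφ.continuous hsφ hsubφ
        (continuousOn_const.mul (continuousOn_lap hU (hcv a)))
    have hI2 : Integrable fun x => φ x * Q a x :=
      integrable_mul_of_tsupport hU hφ.continuous hsφ hsubφ (hQ a)
    have hgreen : ∫ x, ρ * v ρ a x * lap φ x = ∫ x, φ x * (ρ * lap (v ρ a) x) := by
      simp only [mul_assoc, mul_left_comm _ ρ]
      rw [integral_const_mul, integral_const_mul, integral_mul_lap hU hφ hsφ hsubφ (hcv a)]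
    rw [hgreen, ← integral_sub hI1 hI2]
    calc |∫ x, (φ x * (ρ * lap (v ρ a) x) - φ x * Q a x)|
        ≤ ∫ x, |φ x * (ρ * lap (v ρ a) x) - φ x * Q a x| := abs_integral_le_integral_abs
      _ ≤ ∫ x, |K| * C * ((1 + ρ) * (χ x * gradSq (v ρ) x) + (1 / ρ + |δ ρ|) * χ x) := by
          refine integral_mono (hI1.sub hI2).abs
            (((hIS.const_mul _).add (hIχ.const_mul _)).const_mul _) fun x => ?_
          by_cases hx : x ∈ tsupport φ
          · have h1 := ((hρ a).2 x (hsubφ hx)).2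
            -- Weighted AM-GM. The energy is `O(ρ⁻²)`, so with weight `ρ` both terms integrate to
            -- `O(1/ρ)`.
            have h2 : √(gradSq (v ρ) x) ≤ 1 / ρ + ρ * gradSq (v ρ) x := by
              have h3 := Real.sq_sqrt (gradSq_nonneg (v ρ) x)
              have h4 : 0 ≤ (1 / ρ) * (ρ * √(gradSq (v ρ) x) - 1) ^ 2 := by positivity
              have h5 : (1 / ρ) * (ρ * √(gradSq (v ρ) x) - 1) ^ 2
                  = ρ * √(gradSq (v ρ) x) ^ 2 - 2 * √(gradSq (v ρ) x) + 1 / ρ := by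
                field_simp
                ring
              rw [h5, h3] at h4
              have := Real.sqrt_nonneg (gradSq (v ρ) x)
              linarith
            have h6 : |ρ * lap (v ρ a) x - Q a x|
                ≤ C * ((1 + ρ) * gradSq (v ρ) x + (1 / ρ + |δ ρ|)) := by
              refine h1.trans (mul_le_mul_of_nonneg_left ?_ hC)
              linarith [le_abs_self (δ ρ)]
            have h7 : |φ x| ≤ |K| * χ x :=
              (hφχ x).trans (mul_le_mul_of_nonneg_right (le_abs_self K) (hχ0 x))
            calc |φ x * (ρ * lap (v ρ a) x) - φ x * Q a x|
                = |φ x| * |ρ * lap (v ρ a) x - Q a x| := by rw [← mul_sub, abs_mul]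
              _ ≤ |K| * χ x * (C * ((1 + ρ) * gradSq (v ρ) x + (1 / ρ + |δ ρ|))) :=
                  mul_le_mul h7 h6 (abs_nonneg _) ((abs_nonneg _).trans h7)
              _ = _ := by ring
          · simp only [image_eq_zero_of_notMem_tsupport hx, zero_mul, sub_zero, abs_zero]
            have := hχ0 x
            have := gradSq_nonneg (v ρ) x
            positivity
      _ = |K| * C * ((1 + ρ) * (∫ x, χ x * gradSq (v ρ) x) + (1 / ρ + |δ ρ|) * ∫ x, χ x) := by
          rw [integral_const_mul, integral_add (hIS.const_mul _) (hIχ.const_mul _),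
            integral_const_mul, integral_const_mul]
      _ ≤ |K| * C * ((1 + ρ) * ((4 * C / ρ) ^ 2 * M) + (1 / ρ + |δ ρ|) * ∫ x, χ x) := by
          gcongr
      _ = _ := by field_simp
  have hlim : Tendsto (fun ρ : ℝ => C * ((1 / ρ ^ 2 + 1 / ρ) * ((4 * C) ^ 2 * (|K| * M))
        + (1 / ρ + |δ ρ|) * (|K| * ∫ x, χ x))) atTop
      (𝓝 (C * ((0 + 0) * ((4 * C) ^ 2 * (|K| * M)) + (0 + |0|) * (|K| * ∫ x, χ x)))) := by
    have t1 : Tendsto (fun ρ : ℝ => 1 / ρ) atTop (𝓝 0) := tendsto_const_nhds.div_atTop tendsto_id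
    have t2 : Tendsto (fun ρ : ℝ => 1 / ρ ^ 2) atTop (𝓝 0) :=
      tendsto_const_nhds.div_atTop (tendsto_pow_atTop two_ne_zero)
    exact (((t2.add t1).mul_const _).add ((t1.add hδ.abs).mul_const _)).const_mul _
  rw [show C * ((0 + 0) * ((4 * C) ^ 2 * (|K| * M)) + (0 + |0|) * (|K| * ∫ x, χ x)) = 0 by simp]
    at hlim
  rw [tendsto_iff_norm_sub_tendsto_zero]
  exact squeeze_zero' (Eventually.of_forall fun _ => norm_nonneg _) hbound hlim

end Caccioppoli

open Metric

/-! ### Powers of the radius and zonal functions. -/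

section NormPowers

variable {x : E3} {i : Fin 3}

theorem contDiffAt_norm_zpow (hx : x ≠ 0) (n : ℤ) : ContDiffAt ℝ 2 (fun y : E3 => ‖y‖ ^ n) x :=
  ((analyticAt_id.zpow (norm_ne_zero_iff.2 hx)).contDiffAt (f := fun t : ℝ => t ^ n)).comp x
    (contDiffAt_norm ℝ hx)

theorem pd_norm (hx : x ≠ 0) : pd i (fun y : E3 => ‖y‖) x = x i / ‖x‖ := by
  have hd : DifferentiableAt ℝ (fun y : E3 => ‖y‖) x :=
    (contDiffAt_norm ℝ hx (n := 1)).differentiableAt one_ne_zero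
  have h := pd_normSq (x := x) (i := i)
  simp only [sq] at h
  rw [pd_mul hd hd] at h
  have h0 : ‖x‖ ≠ 0 := norm_ne_zero_iff.2 hx
  rw [eq_div_iff h0]
  linarith

theorem lap_norm (hx : x ≠ 0) : lap (fun y : E3 => ‖y‖) x = 2 / ‖x‖ := by
  have hd : ContDiffAt ℝ 2 (fun y : E3 => ‖y‖) x := contDiffAt_norm ℝ hx
  have h := lap_normSq (x := x)
  simp only [sq] at h
  rw [lap_mul hd hd] at h
  have h0 : ‖x‖ ≠ 0 := norm_ne_zero_iff.2 hx
  have h1 : ∑ i, pd i (fun y : E3 => ‖y‖) x * pd i (fun y : E3 => ‖y‖) x = 1 := by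
    simp only [← sq, pd_norm hx, div_pow]
    rw [← Finset.sum_div, ← norm_sq_eq_sum]
    field_simp
  rw [h1] at h
  rw [eq_div_iff h0]
  linarith

theorem pd_norm_zpow (hx : x ≠ 0) (n : ℤ) :
    pd i (fun y : E3 => ‖y‖ ^ n) x = n * ‖x‖ ^ n * (‖x‖ ^ 2)⁻¹ * x i := by
  have h0 : ‖x‖ ≠ 0 := norm_ne_zero_iff.2 hx
  rw [pd_comp (p := fun t => t ^ n) (f := fun y : E3 => ‖y‖)
    (differentiableAt_zpow.2 (Or.inl h0))
    ((contDiffAt_norm ℝ hx (n := 1)).differentiableAt one_ne_zero), pd_norm hx, deriv_zpow,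
    zpow_sub_one₀ h0]
  field_simp

theorem lap_norm_zpow (hx : x ≠ 0) (n : ℤ) :
    lap (fun y : E3 => ‖y‖ ^ n) x = n * (n + 1) * ‖x‖ ^ n * (‖x‖ ^ 2)⁻¹ := by
  have h0 : ‖x‖ ≠ 0 := norm_ne_zero_iff.2 hx
  have h1 : ∑ i, pd i (fun y : E3 => ‖y‖) x ^ 2 = 1 := by
    simp only [pd_norm hx, div_pow]
    rw [← Finset.sum_div, ← norm_sq_eq_sum]
    field_simp
  have h2 : deriv (fun t : ℝ => t ^ n) = fun t => (n : ℝ) * t ^ (n - 1) := by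
    ext t; exact deriv_zpow n t
  rw [lap_comp (p := fun t => t ^ n) (f := fun y : E3 => ‖y‖)
    (analyticAt_id.zpow h0).contDiffAt (contDiffAt_norm ℝ hx), lap_norm hx, h1, h2,
    deriv_const_mul_field, deriv_zpow]
  simp only [zpow_sub_one₀ h0]
  push_cast
  field_simp
  ring

end NormPowers

/-- The Euclidean inner product in coordinates. -/
def dot (e x : E3) : ℝ := ∑ j, e j * x j

theorem dot_eq_inner (e x : E3) : dot e x = inner ℝ x e := by
  simp [dot, PiLp.inner_apply]

theorem dot_comm (e x : E3) : dot e x = dot x e := by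
  simp [dot, mul_comm]

theorem dot_self (e : E3) : dot e e = ‖e‖ ^ 2 := by
  rw [norm_sq_eq_sum]; simp [dot, sq]

theorem dot_smul (e x : E3) (c : ℝ) : dot e (c • x) = c * dot e x := by
  rw [dot_eq_inner, dot_eq_inner, real_inner_smul_left]

theorem continuous_dot (e : E3) : Continuous (dot e) := (contDiff_inner_left (n := 0) e).continuous

theorem abs_dot_le {e x : E3} (he : ‖e‖ = 1) (hx : ‖x‖ = 1) : |dot e x| ≤ 1 := by
  rw [dot_eq_inner]
  simpa [he, hx] using abs_real_inner_le_norm x e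

section Zonal

variable {e x : E3} {p : ℝ → ℝ} {i : Fin 3}

/-- The zonal coordinate `x ⬝ e / ‖x‖`. -/
noncomputable def zonal (e x : E3) : ℝ := dot e x * ‖x‖ ^ (-1 : ℤ)

theorem zonal_eq (e x : E3) : zonal e x = dot e (‖x‖⁻¹ • x) := by
  rw [dot_smul, zonal, zpow_neg_one, mul_comm]

theorem contDiffAt_zonal (hx : x ≠ 0) : ContDiffAt ℝ 2 (zonal e) x :=
  (contDiff_inner_left e).contDiffAt.mul (contDiffAt_norm_zpow hx _)

theorem pd_zonal (hx : x ≠ 0) :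
    pd i (zonal e) x = ‖x‖⁻¹ * e i - dot e x * ‖x‖⁻¹ ^ 3 * x i := by
  have h : zonal e = fun y => (∑ j, e j * y j) * ‖y‖ ^ (-1 : ℤ) := rfl
  rw [h, pd_mul ((contDiff_inner_left (n := 1) e).differentiable one_ne_zero x)
    ((contDiffAt_norm_zpow hx _).differentiableAt two_ne_zero), pd_linear, pd_norm_zpow hx]
  simp only [dot, zpow_neg_one]
  push_cast
  ring

/-- Euler's relation in degree zero; it removes the cross terms between radial and zonal factors. -/
theorem sum_mul_pd_zonal (hx : x ≠ 0) : ∑ i, x i * pd i (zonal e) x = 0 := by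
  have h0 : ‖x‖ ≠ 0 := norm_ne_zero_iff.2 hx
  have h1 : ∀ i, x i * pd i (zonal e) x
      = ‖x‖⁻¹ * (e i * x i) - dot e x * ‖x‖⁻¹ ^ 3 * x i ^ 2 := fun i => by
    rw [pd_zonal hx]; ring
  simp only [h1, Finset.sum_sub_distrib, ← Finset.mul_sum, ← norm_sq_eq_sum]
  change ‖x‖⁻¹ * dot e x - _ = 0
  field_simp
  ring

theorem sum_pd_zonal_sq (he : ‖e‖ = 1) (hx : x ≠ 0) :
    ∑ i, pd i (zonal e) x ^ 2 = (1 - zonal e x ^ 2) * (‖x‖ ^ 2)⁻¹ := by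
  have h0 : ‖x‖ ≠ 0 := norm_ne_zero_iff.2 hx
  have h1 : ∀ i, pd i (zonal e) x ^ 2
      = ‖x‖⁻¹ ^ 2 * e i ^ 2 - 2 * dot e x * ‖x‖⁻¹ ^ 4 * (e i * x i)
        + (dot e x * ‖x‖⁻¹ ^ 3) ^ 2 * x i ^ 2 := fun i => by
    rw [pd_zonal hx]; ring
  simp only [h1, Finset.sum_sub_distrib, Finset.sum_add_distrib, ← Finset.mul_sum,
    ← norm_sq_eq_sum, he]
  change _ - _ * dot e x + _ = _
  simp only [zonal, zpow_neg_one]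
  field_simp
  ring

theorem lap_zonal (hx : x ≠ 0) : lap (zonal e) x = -2 * zonal e x * (‖x‖ ^ 2)⁻¹ := by
  have h0 : ‖x‖ ≠ 0 := norm_ne_zero_iff.2 hx
  have h : zonal e = fun y => (∑ j, e j * y j) * ‖y‖ ^ (-1 : ℤ) := rfl
  rw [h, lap_mul (contDiff_inner_left e).contDiffAt (contDiffAt_norm_zpow hx _), lap_linear,
    lap_norm_zpow hx]
  simp only [pd_linear, pd_norm_zpow hx]
  have h1 : ∀ i, e i * (((-1 : ℤ) : ℝ) * ‖x‖ ^ (-1 : ℤ) * (‖x‖ ^ 2)⁻¹ * x i)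
      = -(‖x‖ ^ (-1 : ℤ) * (‖x‖ ^ 2)⁻¹) * (e i * x i) := fun i => by push_cast; ring
  simp only [h1, ← Finset.mul_sum]
  push_cast
  ring

/-- The operator `Δ_{S²} + 2` on zonal functions. -/
noncomputable def legendre (p : ℝ → ℝ) (t : ℝ) : ℝ :=
  2 * p t + (1 - t ^ 2) * deriv (deriv p) t - 2 * t * deriv p t

/-- Degree-one homogeneity contributes `1·(1+1) = 2` to the spherical operator. Degree `-2`
contributes the same number, so these functions are the right multipliers for `h(x/r)/r²`. -/
theorem lap_norm_mul_zonal (he : ‖e‖ = 1) (hx : x ≠ 0) (hp : ContDiffAt ℝ 2 p (zonal e x)) :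
    lap (fun y => ‖y‖ * p (zonal e y)) x = ‖x‖⁻¹ * legendre p (zonal e x) := by
  have h0 : ‖x‖ ≠ 0 := norm_ne_zero_iff.2 hx
  have hz := contDiffAt_zonal (e := e) hx
  rw [lap_mul (g := fun y => p (zonal e y)) (contDiffAt_norm ℝ hx) (hp.comp x hz), lap_comp hp hz, lap_norm hx,
    sum_pd_zonal_sq he hx, lap_zonal hx]
  have h1 : ∀ i, pd i (fun y : E3 => ‖y‖) x * pd i (fun y => p (zonal e y)) x
      = deriv p (zonal e x) * ‖x‖⁻¹ * (x i * pd i (zonal e) x) := fun i => by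
    rw [pd_norm hx, pd_comp (hp.differentiableAt two_ne_zero) (hz.differentiableAt two_ne_zero)]
    ring
  simp only [h1, ← Finset.mul_sum, sum_mul_pd_zonal hx, legendre]
  field_simp
  ring

theorem sum_mul_pd_norm_mul_zonal (hx : x ≠ 0) (hp : ContDiffAt ℝ 2 p (zonal e x)) :
    ∑ i, x i * pd i (fun y => ‖y‖ * p (zonal e y)) x = ‖x‖ * p (zonal e x) := by
  have h0 : ‖x‖ ≠ 0 := norm_ne_zero_iff.2 hx
  have hz := (contDiffAt_zonal (e := e) hx).differentiableAt two_ne_zero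
  have hpd := hp.differentiableAt two_ne_zero
  have h1 : ∀ i, x i * pd i (fun y => ‖y‖ * p (zonal e y)) x
      = ‖x‖ * deriv p (zonal e x) * (x i * pd i (zonal e) x)
        + p (zonal e x) * ‖x‖⁻¹ * x i ^ 2 := fun i => by
    rw [pd_mul (g := fun y => p (zonal e y)) ((contDiffAt_norm ℝ hx (n := 1)).differentiableAt one_ne_zero)
      (hpd.comp x hz), pd_comp hpd hz, pd_norm hx]
    ring
  simp only [h1, Finset.sum_add_distrib, ← Finset.mul_sum, sum_mul_pd_zonal hx, ← norm_sq_eq_sum]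
  field_simp
  ring

end Zonal

/-! ### From weak harmonicity in space to an orthogonality relation on the sphere. -/

section Polar

/-- The surface measure on the unit sphere. -/
noncomputable abbrev surface : Measure (sphere (0 : E3) 1) := (volume : Measure E3).toSphere

/-- Polar coordinates preserve measure when the radial factor has density `r^(3-1)`; Fubini then
splits the product. -/
theorem integral_polar_mul (a : ℝ → ℝ) (b : E3 → ℝ) :
    ∫ x : E3, a ‖x‖ * b (‖x‖⁻¹ • x)
      = (∫ r in Set.Ioi (0 : ℝ), r ^ 2 * a r) * ∫ θ, b (θ : E3) ∂surface := by
  calc ∫ x : E3, a ‖x‖ * b (‖x‖⁻¹ • x)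
      = ∫ x : ({(0)}ᶜ : Set E3), a ‖x.1‖ * b (‖x.1‖⁻¹ • x.1)
          ∂((volume : Measure E3).comap (↑)) := by
        rw [integral_subtype_comap (measurableSet_singleton _).compl
          fun x : E3 => a ‖x‖ * b (‖x‖⁻¹ • x), restrict_compl_singleton]
    _ = ∫ z, b (z.1 : E3) * a z.2 ∂surface.prod (.volumeIoiPow (Module.finrank ℝ E3 - 1)) := by
        rw [← (volume : Measure E3).measurePreserving_homeomorphUnitSphereProd.integral_comp
          (Homeomorph.measurableEmbedding _)
          (fun z : sphere (0 : E3) 1 × Set.Ioi (0 : ℝ) => b (z.1 : E3) * a z.2)]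
        refine integral_congr_ae (ae_of_all _ fun x => ?_)
        simp [mul_comm]
    _ = (∫ θ, b (θ : E3) ∂surface) *
          ∫ r : Set.Ioi (0 : ℝ), a r ∂.volumeIoiPow (Module.finrank ℝ E3 - 1) :=
        integral_prod_mul (fun θ : sphere (0 : E3) 1 => b θ) (fun r : Set.Ioi (0 : ℝ) => a r)
    _ = _ := by
        rw [mul_comm]
        congr 1
        simp only [Measure.volumeIoiPow, ENNReal.ofReal]
        rw [integral_withDensity_eq_integral_smul, integral_subtype_comap measurableSet_Ioi
          fun r => Real.toNNReal (r ^ (Module.finrank ℝ E3 - 1)) • a r,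
          setIntegral_congr_fun measurableSet_Ioi fun x hx ↦ ?_]
        · rw [NNReal.smul_def, Real.coe_toNNReal _ (pow_nonneg hx.out.le _)]
          simp
        · exact (measurable_subtype_coe.pow_const _).real_toNNReal

/-- The closed shell that carries the test functions. -/
def shell : Set E3 := {x | 2 ≤ ‖x‖ ^ 2 ∧ ‖x‖ ^ 2 ≤ 6}

theorem isClosed_shell : IsClosed shell := by
  have h : Continuous fun x : E3 => ‖x‖ ^ 2 := by fun_prop
  exact (isClosed_le continuous_const h).inter (isClosed_le h continuous_const)

theorem isCompact_shell : IsCompact shell := by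
  refine (isCompact_closedBall (0 : E3) 6).of_isClosed_subset isClosed_shell fun x hx => ?_
  rw [mem_closedBall_zero_iff]
  nlinarith [hx.2, norm_nonneg x]

theorem ne_zero_of_mem_shell {x : E3} (hx : x ∈ shell) : x ≠ 0 := by
  rintro rfl
  have := hx.1
  norm_num at this

theorem hasCompactSupport_of_shell {φ : E3 → ℝ} (h : tsupport φ ⊆ shell) : HasCompactSupport φ :=
  isCompact_shell.of_isClosed_subset (isClosed_tsupport φ) h

/-- A bump function of `‖x‖²` supported in the shell. -/
noncomputable def shellBump : ContDiffBump (4 : ℝ) := ⟨1, 2, one_pos, by norm_num⟩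

theorem tsupport_shellBump : tsupport (fun x : E3 => shellBump (‖x‖ ^ 2)) ⊆ shell := by
  refine closure_minimal (fun x hx => ?_) isClosed_shell
  have h : ‖x‖ ^ 2 ∈ Function.support shellBump := hx
  rw [shellBump.support_eq, Metric.mem_ball, Real.dist_eq, abs_lt] at h
  simp only [shellBump] at h
  exact ⟨by linarith, by linarith⟩

theorem contDiff_shellBump {n : ℕ∞} : ContDiff ℝ n fun x : E3 => shellBump (‖x‖ ^ 2) :=
  shellBump.contDiff.comp contDiff_normSq

theorem tsupport_shellBump_subset_compl : tsupport (fun x : E3 => shellBump (‖x‖ ^ 2)) ⊆ {0}ᶜ :=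
  fun _ hx => ne_zero_of_mem_shell (tsupport_shellBump hx)

theorem continuousOn_norm_inv_pow (n : ℕ) : ContinuousOn (fun x : E3 => (‖x‖ ^ n)⁻¹) {0}ᶜ :=
  ContinuousOn.inv₀ (by fun_prop) fun _ hx => pow_ne_zero _ (norm_ne_zero_iff.2 hx)

/-- Read in space with angular factor `1`, this is the integral of a continuous nonnegative function
that is positive at a point with `‖x‖² = 4`, the centre of the bump. -/
theorem integral_shellBump_ne_zero :
    ∫ r in Set.Ioi (0 : ℝ), r ^ 2 * (shellBump (r ^ 2) / r ^ 3) ≠ 0 := by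
  have h := integral_polar_mul (fun r => shellBump (r ^ 2) / r ^ 3) fun _ => 1
  intro h0
  rw [h0, zero_mul] at h
  have hc : Continuous fun x : E3 => shellBump (‖x‖ ^ 2) * (‖x‖ ^ 3)⁻¹ := by
    have h1 := contDiff_mul_of_tsupport (n := 0) isOpen_compl_singleton
      (contDiff_shellBump (n := 0)) tsupport_shellBump_subset_compl
      (contDiffOn_zero.2 (continuousOn_norm_inv_pow 3))
    exact h1.continuous
  refine (hc.integral_pos_of_hasCompactSupport_nonneg_nonzero (μ := volume)
    (hasCompactSupport_of_shell tsupport_shellBump).mul_right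
    (fun x => mul_nonneg shellBump.nonneg (by positivity))
    (x := EuclideanSpace.single (0 : Fin 3) (2 : ℝ)) ?_).ne' ?_
  · have h2 : shellBump (2 ^ 2 : ℝ) = 1 :=
      shellBump.one_of_mem_closedBall (by simp [shellBump, Real.dist_eq]; norm_num)
    simp [h2]
  · simpa [div_eq_mul_inv] using h

/-- The integrand is an exact derivative: for the bump `β`, a primitive is `2r²β'(r²) + 3β(r²)`,
which vanishes at `0` and for large `r`. The terms in which derivatives fall on the bump thus drop
out. -/
theorem integral_shellBump_radial : ∫ r in Set.Ioi (0 : ℝ), r ^ 2 *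
    ((10 * deriv shellBump (r ^ 2) + 4 * r ^ 2 * deriv (deriv shellBump) (r ^ 2)) / r) = 0 := by
  have hβ : ContDiff ℝ 3 shellBump := shellBump.contDiff
  have hβ1 : ContDiff ℝ 2 (deriv shellBump) :=
    ((contDiff_succ_iff_deriv (n := 2)).1 hβ).2.2
  have hβ0 : shellBump (0 : ℝ) = 0 := by
    refine shellBump.zero_of_le_dist ?_
    simp [shellBump, Real.dist_eq]
    norm_num
  set G : ℝ → ℝ := fun r => 2 * r ^ 2 * deriv shellBump (r ^ 2) + 3 * shellBump (r ^ 2) with hG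
  have hGc : ContDiff ℝ 1 G := by
    have h1 : ContDiff ℝ 1 fun r : ℝ => deriv shellBump (r ^ 2) :=
      (hβ1.of_le (by norm_num)).comp (contDiff_id.pow 2)
    have h2 : ContDiff ℝ 1 fun r : ℝ => shellBump (r ^ 2) :=
      (hβ.of_le (by norm_num)).comp (contDiff_id.pow 2)
    exact ((contDiff_const.mul (contDiff_id.pow 2)).mul h1).add (contDiff_const.mul h2)
  have hGs : HasCompactSupport G := by
    refine HasCompactSupport.intro (isCompact_closedBall (0 : ℝ) 3) fun r hr => ?_
    have hr : 9 < r ^ 2 := by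
      rw [mem_closedBall_zero_iff, Real.norm_eq_abs, not_le] at hr
      nlinarith [sq_abs r]
    have h1 : r ^ 2 ∉ tsupport shellBump := by
      rw [shellBump.tsupport_eq, mem_closedBall, Real.dist_eq, not_le, lt_abs]
      left; simp only [shellBump]; linarith
    simp only [hG]
    rw [image_eq_zero_of_notMem_tsupport h1,
      image_eq_zero_of_notMem_tsupport fun h => h1 (tsupport_deriv_subset h)]
    ring
  have hd : ∀ r, deriv G r
      = 4 * r ^ 3 * deriv (deriv shellBump) (r ^ 2) + 10 * r * deriv shellBump (r ^ 2) := by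
    intro r
    have h1 : HasDerivAt (fun r : ℝ => r ^ 2) (2 * r) r := by
      simpa using hasDerivAt_pow 2 r
    have h2 := (hβ.differentiable (by norm_num) (r ^ 2)).hasDerivAt.comp r h1
    have h3 := (hβ1.differentiable two_ne_zero (r ^ 2)).hasDerivAt.comp r h1
    have h4 := ((h1.const_mul 2).mul h3).add (h2.const_mul 3)
    refine (h4.congr_deriv ?_).deriv
    simp only [Function.comp]
    ring
  have hI := hGs.integral_Ioi_deriv_eq hGc 0
  have hG0 : G 0 = 0 := by simp [hG, hβ0]
  rw [hG0, neg_zero] at hI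
  refine (setIntegral_congr_fun measurableSet_Ioi fun r hr => ?_).trans hI
  have hr0 : r ≠ 0 := (Set.mem_Ioi.1 hr).ne'
  simp only [hd]
  field_simp
  ring

/-- `h(x/‖x‖)/‖x‖²` is harmonic in the sense of distributions. -/
def WeaklyHarmonic (h : E3 → ℝ) : Prop :=
  ∀ φ : E3 → ℝ, ContDiff ℝ 2 φ → tsupport φ ⊆ shell →
    ∫ x, h (‖x‖⁻¹ • x) / ‖x‖ ^ 2 * lap φ x = 0

theorem norm_inv_smul_mem_sphere {x : E3} (hx : x ≠ 0) : ‖x‖⁻¹ • x ∈ sphere (0 : E3) 1 := by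
  simp [norm_smul, norm_ne_zero_iff.2 hx]

theorem continuousOn_comp_direction {b : E3 → ℝ} (hb : ContinuousOn b (sphere 0 1)) :
    ContinuousOn (fun x : E3 => b (‖x‖⁻¹ • x)) {0}ᶜ :=
  hb.comp ((continuous_norm.continuousOn.inv₀ fun _ hx => norm_ne_zero_iff.2 hx).smul
    continuousOn_id) fun _ hx => norm_inv_smul_mem_sphere hx

theorem continuousOn_legendre {p : ℝ → ℝ} {V : Set ℝ} (hV : IsOpen V) (hp : ContDiffOn ℝ 2 p V) :
    ContinuousOn (legendre p) V := by
  have h1 : ContDiffOn ℝ 1 (deriv p) V := hp.deriv_of_isOpen hV (by norm_num)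
  have h2 : ContDiffOn ℝ 0 (deriv (deriv p)) V := h1.deriv_of_isOpen hV (by norm_num)
  have := hp.continuousOn
  have := h1.continuousOn
  have := h2.continuousOn
  unfold legendre
  fun_prop

theorem dot_mem_Icc {e x : E3} (he : ‖e‖ = 1) (hx : ‖x‖ = 1) : dot e x ∈ Set.Icc (-1 : ℝ) 1 :=
  abs_le.1 (abs_dot_le he hx)

/-- Testing weak harmonicity with zonal functions. -/
theorem WeaklyHarmonic.integral_legendre {h : E3 → ℝ} (hw : WeaklyHarmonic h)
    (hc : ContinuousOn h (sphere 0 1)) {e : E3} (he : ‖e‖ = 1) {p : ℝ → ℝ} {V : Set ℝ}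
    (hV : IsOpen V) (hIcc : Set.Icc (-1) 1 ⊆ V) (hp : ContDiffOn ℝ 2 p V) :
    ∫ θ, h (θ : E3) * legendre p (dot e θ) ∂surface = 0 := by
  have hz : ∀ x : E3, x ≠ 0 → zonal e x ∈ V := fun x hx => by
    rw [zonal_eq]
    exact hIcc (dot_mem_Icc he (mem_sphere_zero_iff_norm.1 (norm_inv_smul_mem_sphere hx)))
  have hpx : ∀ x : E3, x ≠ 0 → ContDiffAt ℝ 2 p (zonal e x) := fun x hx =>
    hp.contDiffAt (hV.mem_nhds (hz x hx))
  have hP : ∀ x : E3, x ≠ 0 → ContDiffAt ℝ 2 (fun y => ‖y‖ * p (zonal e y)) x := fun x hx =>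
    (contDiffAt_norm ℝ hx).mul ((hpx x hx).comp x (contDiffAt_zonal hx))
  set φ : E3 → ℝ := fun x => shellBump (‖x‖ ^ 2) * (‖x‖ * p (zonal e x)) with hφ
  have hφc : ContDiff ℝ 2 φ := contDiff_mul_of_tsupport isOpen_compl_singleton
    (contDiff_shellBump (n := 2)) tsupport_shellBump_subset_compl
    fun x hx => (hP x hx).contDiffWithinAt
  have hφs : tsupport φ ⊆ shell := (tsupport_mul_subset_left).trans tsupport_shellBump
  have h0 := hw φ hφc hφs
  -- The `10` is `6` from the Laplacian of the radial bump plus `4` from the cross term, evaluated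
  -- by Euler's relation in degree one.
  have hlapφ : ∀ x, x ≠ 0 → lap φ x = shellBump (‖x‖ ^ 2) * (‖x‖⁻¹ * legendre p (zonal e x))
      + (10 * deriv shellBump (‖x‖ ^ 2) + 4 * ‖x‖ ^ 2 * deriv (deriv shellBump) (‖x‖ ^ 2))
        * (‖x‖ * p (zonal e x)) := by
    intro x hx
    rw [lap_mul (contDiff_shellBump (n := 2)).contDiffAt (hP x hx),
      lap_norm_mul_zonal he hx (hpx x hx), lap_radial shellBump.contDiff.contDiffAt]
    have h1 : ∀ i, pd i (fun y : E3 => shellBump (‖y‖ ^ 2)) x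
        * pd i (fun y => ‖y‖ * p (zonal e y)) x
        = 2 * deriv shellBump (‖x‖ ^ 2) * (x i * pd i (fun y => ‖y‖ * p (zonal e y)) x) := by
      intro i
      rw [pd_radial ((shellBump.contDiff (n := 1)).differentiable one_ne_zero _)]
      ring
    simp only [h1, ← Finset.mul_sum, sum_mul_pd_norm_mul_zonal hx (hpx x hx)]
    ring
  have hdecomp : ∀ x, h (‖x‖⁻¹ • x) / ‖x‖ ^ 2 * lap φ x
      - shellBump (‖x‖ ^ 2) / ‖x‖ ^ 3 * (h (‖x‖⁻¹ • x) * legendre p (dot e (‖x‖⁻¹ • x)))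
      = (10 * deriv shellBump (‖x‖ ^ 2) + 4 * ‖x‖ ^ 2 * deriv (deriv shellBump) (‖x‖ ^ 2)) / ‖x‖
        * (h (‖x‖⁻¹ • x) * p (dot e (‖x‖⁻¹ • x))) := by
    intro x
    rcases eq_or_ne x 0 with rfl | hx
    · simp
    · have hn : ‖x‖ ≠ 0 := norm_ne_zero_iff.2 hx
      rw [hlapφ x hx, ← zonal_eq]
      field_simp
      ring
  have hL : ContinuousOn (fun θ : E3 => h θ * legendre p (dot e θ)) (sphere 0 1) :=
    hc.mul ((continuousOn_legendre hV hp).comp (continuous_dot e).continuousOn fun θ hθ =>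
      hIcc (dot_mem_Icc he (mem_sphere_zero_iff_norm.1 hθ)))
  have hI1 : Integrable fun x : E3 =>
      shellBump (‖x‖ ^ 2) / ‖x‖ ^ 3 * (h (‖x‖⁻¹ • x) * legendre p (dot e (‖x‖⁻¹ • x))) := by
    have := integrable_mul_of_tsupport isOpen_compl_singleton
      (contDiff_shellBump (n := 0)).continuous (hasCompactSupport_of_shell tsupport_shellBump)
      tsupport_shellBump_subset_compl
      ((continuousOn_norm_inv_pow 3).mul (continuousOn_comp_direction hL))
    simpa only [div_eq_mul_inv, mul_assoc, Pi.mul_apply] using this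
  have hI2 : Integrable fun x : E3 => h (‖x‖⁻¹ • x) / ‖x‖ ^ 2 * lap φ x := by
    have hls : tsupport (lap φ) ⊆ shell := tsupport_lap_subset.trans hφs
    have := integrable_mul_of_tsupport isOpen_compl_singleton (continuous_lap hφc)
      (hasCompactSupport_of_shell hls) (fun x hx => ne_zero_of_mem_shell (hls hx))
      ((continuousOn_comp_direction hc).mul (continuousOn_norm_inv_pow 2))
    simpa only [div_eq_mul_inv, mul_comm, Pi.mul_apply] using this
  have h3 := integral_sub hI2 hI1
  simp only [hdecomp] at h3
  rw [integral_polar_mul (fun r => (10 * deriv shellBump (r ^ 2)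
      + 4 * r ^ 2 * deriv (deriv shellBump) (r ^ 2)) / r) (fun θ => h θ * p (dot e θ)),
    integral_shellBump_radial, h0, zero_mul,
    integral_polar_mul (fun r => shellBump (r ^ 2) / r ^ 3)
      (fun θ => h θ * legendre p (dot e θ))] at h3
  have h4 : (∫ r in Set.Ioi (0 : ℝ), r ^ 2 * (shellBump (r ^ 2) / r ^ 3))
      * ∫ θ, h (θ : E3) * legendre p (dot e θ) ∂surface = 0 := by linarith
  exact (mul_eq_zero.1 h4).resolve_left integral_shellBump_ne_zero

/-- The extension `(e·x)|x|⁻³` is a dipole potential, harmonic off the origin. It is the model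
solution against which a general `h` is compared, so the mass of the concentrating kernels need not
be computed. -/
theorem weaklyHarmonic_dot (e : E3) : WeaklyHarmonic (dot e) := by
  intro φ hφ hs
  have hg : ∀ x : E3, x ≠ 0 → ContDiffAt ℝ 2 (fun y => dot e y * ‖y‖ ^ (-3 : ℤ)) x := fun x hx =>
    (contDiff_inner_left e).contDiffAt.mul (contDiffAt_norm_zpow hx _)
  have hlap : ∀ x : E3, x ≠ 0 → lap (fun y => dot e y * ‖y‖ ^ (-3 : ℤ)) x = 0 := by
    intro x hx
    have h : (fun y => dot e y * ‖y‖ ^ (-3 : ℤ)) = fun y => (∑ j, e j * y j) * ‖y‖ ^ (-3 : ℤ) := rfl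
    rw [h, lap_mul (contDiff_inner_left e).contDiffAt (contDiffAt_norm_zpow hx _), lap_linear,
      lap_norm_zpow hx]
    simp only [pd_linear, pd_norm_zpow hx]
    have h1 : ∀ i, e i * (((-3 : ℤ) : ℝ) * ‖x‖ ^ (-3 : ℤ) * (‖x‖ ^ 2)⁻¹ * x i)
        = -3 * (‖x‖ ^ (-3 : ℤ) * (‖x‖ ^ 2)⁻¹) * (e i * x i) := fun i => by push_cast; ring
    simp only [h1, ← Finset.mul_sum]
    push_cast
    ring
  have hG := integral_mul_lap isOpen_compl_singleton hφ (hasCompactSupport_of_shell hs)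
    (fun x hx => ne_zero_of_mem_shell (hs hx)) (fun x hx => (hg x hx).contDiffWithinAt)
  have h1 : ∀ x, dot e (‖x‖⁻¹ • x) / ‖x‖ ^ 2 * lap φ x
      = dot e x * ‖x‖ ^ (-3 : ℤ) * lap φ x := fun x => by
    rw [dot_smul, zpow_neg, show ‖x‖ ^ (3 : ℤ) = ‖x‖ ^ 3 from by norm_cast]
    simp only [div_eq_mul_inv]
    ring
  simp only [h1]
  rw [hG]
  refine integral_eq_zero_of_ae (ae_of_all _ fun x => ?_)
  by_cases hx : x ∈ tsupport φ
  · simp only [hlap x (ne_zero_of_mem_shell (hs hx)), mul_zero, Pi.zero_apply]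
  · simp [image_eq_zero_of_notMem_tsupport hx]

end Polar

/-! ### Concentrating kernels and rigidity of weak solutions of `(Δ_{S²} + 2)h = 0`. -/

section Rigidity

/-- `Δ_{S²} + 2` applied to the regularised Green function, up to a first-order harmonic. -/
noncomputable def peak (ε t : ℝ) : ℝ :=
  -2 * ε + ε * (2 + ε) / (1 + ε - t) + (1 + ε) * ε * (2 + ε) / (1 + ε - t) ^ 2

theorem legendre_log {ε t : ℝ} (ht : t < 1 + ε) :
    legendre (fun t => t * Real.log (1 + ε - t) + 1) t = peak ε t - 3 * t := by
  have h1 : ∀ t < 1 + ε, HasDerivAt (fun t => t * Real.log (1 + ε - t) + 1)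
      (Real.log (1 + ε - t) - t / (1 + ε - t)) t := by
    intro t ht
    have h0 : 1 + ε - t ≠ 0 := by linarith
    have := (((hasDerivAt_id t).mul (((hasDerivAt_id t).const_sub (1 + ε)).log h0)).add_const 1)
    refine this.congr_deriv ?_
    simp only [id]
    field_simp
    ring
  have h2 : deriv (deriv fun t => t * Real.log (1 + ε - t) + 1) t
      = -1 / (1 + ε - t) - (1 + ε) / (1 + ε - t) ^ 2 := by
    have h0 : 1 + ε - t ≠ 0 := by linarith
    have he : (deriv fun t => t * Real.log (1 + ε - t) + 1)
        =ᶠ[𝓝 t] fun t => Real.log (1 + ε - t) - t / (1 + ε - t) := by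
      filter_upwards [Iio_mem_nhds ht] with s hs using (h1 s hs).deriv
    rw [he.deriv_eq]
    have hs := (hasDerivAt_id t).const_sub (1 + ε)
    have := (hs.log h0).sub ((hasDerivAt_id t).div hs h0)
    refine (this.congr_deriv ?_).deriv
    simp only [id]
    field_simp
    ring
  have h0 : 1 + ε - t ≠ 0 := by linarith
  rw [legendre, h2, (h1 t ht).deriv, peak]
  field_simp
  ring

theorem contDiffOn_log (ε : ℝ) :
    ContDiffOn ℝ 2 (fun t => t * Real.log (1 + ε - t) + 1) (Set.Iio (1 + ε)) :=
  (contDiffOn_id.mul ((contDiffOn_const.sub contDiffOn_id).log fun t ht => by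
    have : t < 1 + ε := ht
    simp only [id]
    linarith)).add contDiffOn_const

theorem integrable_surface {f : E3 → ℝ} (hf : ContinuousOn f (sphere 0 1)) :
    Integrable (fun θ : sphere (0 : E3) 1 => f θ) surface := by
  have : Continuous fun θ : sphere (0 : E3) 1 => f θ :=
    continuousOn_iff_continuous_domRestrict.1 hf
  exact this.integrable_of_hasCompactSupport (HasCompactSupport.of_compactSpace _)

theorem continuousOn_peak {ε : ℝ} (hε : 0 < ε) {e : E3} (he : ‖e‖ = 1) :
    ContinuousOn (fun θ => peak ε (dot e θ)) (sphere 0 1) := by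
  have hd : ∀ θ ∈ sphere (0 : E3) 1, 1 + ε - dot e θ ≠ 0 := fun θ hθ => by
    have := (dot_mem_Icc he (mem_sphere_zero_iff_norm.1 hθ)).2
    linarith
  have hc : ContinuousOn (fun θ => 1 + ε - dot e θ) (sphere 0 1) :=
    (continuous_const.sub (continuous_dot e)).continuousOn
  unfold peak
  exact (continuousOn_const.add (continuousOn_const.div hc hd)).add
    (continuousOn_const.div (hc.pow 2) fun θ hθ => pow_ne_zero 2 (hd θ hθ))

theorem WeaklyHarmonic.integral_peak {h : E3 → ℝ} (hw : WeaklyHarmonic h)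
    (hc : ContinuousOn h (sphere 0 1)) {e : E3} (he : ‖e‖ = 1) {ε : ℝ} (hε : 0 < ε) :
    ∫ θ, h (θ : E3) * peak ε (dot e θ) ∂surface = 3 * ∫ θ, h (θ : E3) * dot e θ ∂surface := by
  have h1 := hw.integral_legendre hc he isOpen_Iio
    (fun t ht => show t < 1 + ε by linarith [ht.2]) (contDiffOn_log ε)
  have h2 : ∀ θ : sphere (0 : E3) 1,
      h (θ : E3) * legendre (fun t => t * Real.log (1 + ε - t) + 1) (dot e θ)
      = h (θ : E3) * peak ε (dot e θ) - 3 * (h (θ : E3) * dot e θ) := fun θ => by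
    have := (dot_mem_Icc he (mem_sphere_zero_iff_norm.1 θ.2)).2
    rw [legendre_log (by linarith)]
    ring
  simp only [h2] at h1
  rw [integral_sub (integrable_surface (hc.fun_mul (continuousOn_peak hε he)))
    ((integrable_surface (hc.fun_mul (continuous_dot e).continuousOn)).const_mul 3),
    integral_const_mul] at h1
  linarith

/-- Every term of the kernel carries a factor `ε` and its pole is at `1 + ε`, so away from `t = 1`
it is `O(ε)`. The constants come from `2 + ε ≤ 3` and `(1+ε)(2+ε) ≤ 6`. -/
theorem abs_peak_le {ε t τ : ℝ} (hε : 0 < ε) (hε1 : ε ≤ 1) (hτ : τ < 1) (ht : t ≤ τ) :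
    |peak ε t| ≤ ε * (2 + 3 / (1 - τ) + 6 / (1 - τ) ^ 2) := by
  have hs : 1 - τ ≤ 1 + ε - t := by linarith
  have h0 : 0 < 1 - τ := by linarith
  have h1 : 0 < 1 + ε - t := by linarith
  have a1 : ε * (2 + ε) / (1 + ε - t) ≤ ε * 3 / (1 - τ) := by
    gcongr; linarith
  have a2 : (1 + ε) * ε * (2 + ε) / (1 + ε - t) ^ 2 ≤ ε * 6 / (1 - τ) ^ 2 := by
    have h6 : (1 + ε) * ε * (2 + ε) ≤ ε * 6 := by nlinarith [mul_pos hε hε]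
    gcongr
  have b1 : 0 ≤ ε * (2 + ε) / (1 + ε - t) := by positivity
  have b2 : 0 ≤ (1 + ε) * ε * (2 + ε) / (1 + ε - t) ^ 2 := by positivity
  have e1 : ε * (2 + 3 / (1 - τ) + 6 / (1 - τ) ^ 2)
      = 2 * ε + ε * 3 / (1 - τ) + ε * 6 / (1 - τ) ^ 2 := by ring
  rw [e1, peak, abs_le]
  constructor <;> linarith

theorem peak_add_nonneg {ε t : ℝ} (hε : 0 < ε) (ht : t ≤ 1) : 0 ≤ peak ε t + 2 * ε := by
  have h1 : 0 < 1 + ε - t := by linarith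
  have b1 : 0 ≤ ε * (2 + ε) / (1 + ε - t) := by positivity
  have b2 : 0 ≤ (1 + ε) * ε * (2 + ε) / (1 + ε - t) ^ 2 := by positivity
  rw [peak]; linarith

theorem le_of_forall_le_add_mul {a b c : ℝ} (h : ∀ ε, 0 < ε → ε ≤ 1 → c ≤ a + ε * b) : c ≤ a := by
  have ht : Tendsto (fun ε : ℝ => a + ε * b) (𝓝[>] 0) (𝓝 (a + 0 * b)) :=
    ((tendsto_id.mono_left nhdsWithin_le_nhds).mul_const b).const_add a
  rw [zero_mul, add_zero] at ht
  refine ge_of_tendsto ht ?_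
  filter_upwards [Ioc_mem_nhdsGT (zero_lt_one (α := ℝ))] with ε hε using h ε hε.1 hε.2

/-- If `h` vanishes at `e`, the concentrating kernels force its first moment along `e` to vanish. -/
theorem integral_mul_dot_eq_zero {h : E3 → ℝ} (hc : ContinuousOn h (sphere 0 1)) {e : E3}
    (he : ‖e‖ = 1) (h0 : h e = 0)
    (hp : ∀ ε > 0, ∫ θ, h (θ : E3) * peak ε (dot e θ) ∂surface
      = 3 * ∫ θ, h (θ : E3) * dot e θ ∂surface) :
    ∫ θ, h (θ : E3) * dot e θ ∂surface = 0 := by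
  obtain ⟨M, hM⟩ := (isCompact_sphere (0 : E3) 1).exists_bound_of_continuousOn hc
  have hM0 : 0 ≤ M := (norm_nonneg _).trans (hM e (by simpa using he))
  set J := ∫ θ, h (θ : E3) * dot e θ ∂surface with hJ
  set m := ∫ θ : sphere (0 : E3) 1, dot e (θ : E3) * dot e θ ∂surface with hm
  have hdc : ContinuousOn (dot e) (sphere 0 1) := (continuous_dot e).continuousOn
  -- Here `η` bounds `|h|` near `e`. For fixed `η` the parameter `ε` goes to `0` first.
  have main : ∀ η, 0 < η → η ≤ 1 → |3 * J| ≤ 0 + η * (6 * m) := by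
    intro η hη _
    rw [zero_add]
    obtain ⟨δ, hδ, hδh⟩ := Metric.continuousOn_iff.1 hc e (by simpa using he) η hη
    -- Since `‖θ - e‖² = 2 - 2t`, the condition `t > 1 - δ²/2` means distance less than `δ`; the
    -- bound `t > 1/2` makes `2t ≥ 1` on the cap.
    set τ : ℝ := max (1 / 2) (1 - δ ^ 2 / 2) with hτ
    have hτ1 : τ < 1 := max_lt (by norm_num) (by nlinarith)
    have hnear : ∀ θ ∈ sphere (0 : E3) 1, τ < dot e θ → |h θ| ≤ η := by
      intro θ hθ ht
      have h1 : ‖θ - e‖ ^ 2 = 2 - 2 * dot e θ := by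
        rw [norm_sub_sq_real, dot_eq_inner, he, mem_sphere_zero_iff_norm.1 hθ]; ring
      have h2 : 1 - δ ^ 2 / 2 < dot e θ := (le_max_right _ _).trans_lt ht
      have h3 : dist θ e < δ := by
        rw [dist_eq_norm]
        exact lt_of_pow_lt_pow_left₀ 2 hδ.le (by linarith)
      have h4 := hδh θ hθ h3
      rw [h0, Real.dist_eq, sub_zero] at h4
      exact h4.le
    set Cτ : ℝ := 2 + 3 / (1 - τ) + 6 / (1 - τ) ^ 2 with hCτ
    have hCτ0 : 0 ≤ Cτ := by
      have : 0 < 1 - τ := by linarith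
      positivity
    refine le_of_forall_le_add_mul
      (b := ((M + 2 * η) * Cτ + 6 * η) * (surface : Measure (sphere (0 : E3) 1)).real Set.univ)
      fun ε hε hε1 => ?_
    -- The kernel is dominated on the cap by `2t` times itself up to `O(ε)`, and is `O(ε)` off the
    -- cap. The integral of `t * peak ε t` is exactly `3m`, since `dot e` is a solution.
    have hpt : ∀ θ : sphere (0 : E3) 1, |h (θ : E3) * peak ε (dot e θ)|
        ≤ 2 * η * (dot e (θ : E3) * peak ε (dot e θ)) + ε * ((M + 2 * η) * Cτ + 6 * η) := by
      intro θ
      have htI := dot_mem_Icc he (mem_sphere_zero_iff_norm.1 θ.2)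
      have hθM : |h θ| ≤ M := hM θ θ.2
      set t := dot e (θ : E3) with ht
      rw [abs_mul]
      rcases le_or_gt t τ with hle | hgt
      · have hpk := abs_peak_le hε hε1 hτ1 hle
        rw [← hCτ] at hpk
        have h1 : |h θ| * |peak ε t| ≤ M * (ε * Cτ) :=
          mul_le_mul hθM hpk (abs_nonneg _) hM0
        have h2 : |t * peak ε t| ≤ 1 * (ε * Cτ) := by
          rw [abs_mul]
          exact mul_le_mul (abs_le.2 htI) hpk (abs_nonneg _) zero_le_one
        have h3 := mul_le_mul_of_nonneg_left (neg_le_of_abs_le h2) (by positivity : 0 ≤ 2 * η)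
        have h4 : 0 ≤ ε * (6 * η) := by positivity
        linarith
      · have hpn := peak_add_nonneg hε htI.2
        have ht2 : 1 / 2 ≤ t := (le_max_left _ _).trans hgt.le
        have h1 : |peak ε t| ≤ (peak ε t + 2 * ε) + 2 * ε := by
          rw [abs_le]; constructor <;> linarith
        have h2 : |h θ| * |peak ε t| ≤ η * ((peak ε t + 2 * ε) + 2 * ε) :=
          mul_le_mul (hnear θ θ.2 hgt) h1 (abs_nonneg _) hη.le
        have h3 : peak ε t + 2 * ε ≤ 2 * t * (peak ε t + 2 * ε) := by nlinarith
        have h4 : η * ((peak ε t + 2 * ε) + 2 * ε) ≤ η * (2 * t * (peak ε t + 2 * ε) + 2 * ε) := by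
          gcongr
        have h5 : η * ε * t ≤ η * ε := mul_le_of_le_one_right (by positivity) htI.2
        have h6 : 0 ≤ ε * ((M + 2 * η) * Cτ) := by positivity
        linarith
    have hIp : Integrable (fun θ : sphere (0 : E3) 1 => h (θ : E3) * peak ε (dot e θ)) surface :=
      integrable_surface (hc.fun_mul (continuousOn_peak hε he))
    have hIt : Integrable (fun θ : sphere (0 : E3) 1 => dot e (θ : E3) * peak ε (dot e θ))
        surface := integrable_surface (hdc.fun_mul (continuousOn_peak hε he))
    calc |3 * J| = |∫ θ, h (θ : E3) * peak ε (dot e θ) ∂surface| := by rw [hp ε hε]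
      _ ≤ ∫ θ, |h (θ : E3) * peak ε (dot e θ)| ∂surface := abs_integral_le_integral_abs
      _ ≤ ∫ θ : sphere (0 : E3) 1, (2 * η * (dot e (θ : E3) * peak ε (dot e θ))
            + ε * ((M + 2 * η) * Cτ + 6 * η)) ∂surface :=
          integral_mono hIp.abs ((hIt.const_mul _).add (integrable_const _)) hpt
      _ = _ := by
          rw [integral_add (hIt.const_mul _) (integrable_const _), integral_const_mul,
            (weaklyHarmonic_dot e).integral_peak hdc he hε, integral_const, smul_eq_mul, hm]
          ring
  have h3 : |3 * J| ≤ 0 := le_of_forall_le_add_mul main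
  have := abs_nonpos_iff.1 h3
  linarith

/-- The Funk–Hecke identity for first-order spherical harmonics. -/
theorem WeaklyHarmonic.integral_mul_dot {h : E3 → ℝ} (hw : WeaklyHarmonic h)
    (hc : ContinuousOn h (sphere 0 1)) {e : E3} (he : ‖e‖ = 1) :
    ∫ θ, h (θ : E3) * dot e θ ∂surface = h e * ∫ θ : sphere (0 : E3) 1, dot e (θ : E3) * dot e θ ∂surface := by
  have hdc : ContinuousOn (dot e) (sphere 0 1) := (continuous_dot e).continuousOn
  have hsub : ∀ f : E3 → ℝ, ContinuousOn f (sphere 0 1) →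
      ∫ θ, (h (θ : E3) - h e * dot e θ) * f θ ∂surface = (∫ θ, h (θ : E3) * f θ ∂surface)
        - h e * ∫ θ : sphere (0 : E3) 1, dot e (θ : E3) * f θ ∂surface := by
    intro f hf
    rw [← integral_const_mul, ← integral_sub (integrable_surface (hc.fun_mul hf))
      ((integrable_surface (hdc.fun_mul hf)).const_mul _)]
    refine integral_congr_ae (ae_of_all _ fun θ => ?_)
    ring
  -- Subtracting `h e * dot e` creates a zero at `e`, because `dot e e = 1`, and keeps the kernel
  -- identity by linearity.
  have h1 := integral_mul_dot_eq_zero (h := fun θ => h θ - h e * dot e θ) (e := e)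
    (hc.sub (continuousOn_const.mul hdc)) he (by simp [dot_self, he]) fun ε hε => by
      rw [hsub _ (continuousOn_peak hε he), hsub _ hdc, hw.integral_peak hc he hε,
        (weaklyHarmonic_dot e).integral_peak hdc he hε]
      ring
  rw [hsub _ hdc] at h1
  linarith

/-- The second moment of the unit sphere in the direction `e`. -/
noncomputable def moment (e : E3) : ℝ :=
  ∫ θ : sphere (0 : E3) 1, dot e (θ : E3) * dot e θ ∂surface

theorem moment_pos {e : E3} (he : ‖e‖ = 1) : 0 < moment e := by
  have hc : Continuous fun θ : sphere (0 : E3) 1 => dot e (θ : E3) * dot e θ :=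
    ((continuous_dot e).comp continuous_subtype_val).mul
      ((continuous_dot e).comp continuous_subtype_val)
  refine hc.integral_pos_of_hasCompactSupport_nonneg_nonzero (HasCompactSupport.of_compactSpace _)
    (fun θ => mul_self_nonneg _) (x := ⟨e, by simpa using he⟩) ?_
  simp [dot_self, he]

/-- Funk–Hecke evaluates `∫ (a·θ)(e·θ)` both as `(a·e)` times the moment of `e` and as `(a·e)` times
the moment of `a`. No rotation invariance of the measure is used. -/
theorem moment_eq_of_dot_ne_zero {a e : E3} (ha : ‖a‖ = 1) (he : ‖e‖ = 1) (h : dot a e ≠ 0) :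
    moment a = moment e := by
  have h1 := (weaklyHarmonic_dot a).integral_mul_dot (continuous_dot a).continuousOn he
  have h2 := (weaklyHarmonic_dot e).integral_mul_dot (continuous_dot e).continuousOn ha
  have h3 : ∫ θ : sphere (0 : E3) 1, dot a (θ : E3) * dot e θ ∂surface
      = ∫ θ : sphere (0 : E3) 1, dot e (θ : E3) * dot a θ ∂surface := by simp only [mul_comm]
  rw [h3, h2, dot_comm e a] at h1
  exact mul_left_cancel₀ h h1

/-- Orthogonal vectors are compared through the normalised sum `a + e`, which is orthogonal to
neither. -/
theorem moment_eq {a e : E3} (ha : ‖a‖ = 1) (he : ‖e‖ = 1) : moment a = moment e := by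
  by_cases h : dot a e = 0
  · have hin : inner ℝ a e = (0 : ℝ) := by rw [dot_comm, dot_eq_inner] at h; exact h
    have hs : ‖a + e‖ ^ 2 = 2 := by
      rw [norm_add_sq_real, hin, ha, he]; norm_num
    have hs0 : ‖a + e‖ ≠ 0 := by intro h0; rw [h0] at hs; norm_num at hs
    have hb : ‖‖a + e‖⁻¹ • (a + e)‖ = 1 := by
      rw [norm_smul, norm_inv, norm_norm, inv_mul_cancel₀ hs0]
    have h1 : dot a (a + e) = 1 := by
      rw [dot_eq_inner, inner_add_left, real_inner_self_eq_norm_sq, ha, real_inner_comm, hin]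
      norm_num
    have h2 : dot e (a + e) = 1 := by
      rw [dot_eq_inner, inner_add_left, real_inner_self_eq_norm_sq, he, hin]
      norm_num
    rw [moment_eq_of_dot_ne_zero ha hb (by rw [dot_smul, h1]; simp [hs0]),
      moment_eq_of_dot_ne_zero he hb (by rw [dot_smul, h2]; simp [hs0])]
  · exact moment_eq_of_dot_ne_zero ha he h

/-- The functions on the sphere whose homogeneous extension of degree `-2` is weakly harmonic
are the first-order spherical harmonics. -/
theorem WeaklyHarmonic.exists_linear {h : E3 → ℝ} (hw : WeaklyHarmonic h)
    (hc : ContinuousOn h (sphere 0 1)) :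
    ∃ c : Fin 3 → ℝ, ∀ X : E3, ‖X‖ = 1 → h X = ∑ i, c i * X i := by
  set m := moment (EuclideanSpace.single 0 1) with hm
  have hm0 : m ≠ 0 := (moment_pos (by simp)).ne'
  refine ⟨fun i => m⁻¹ * ∫ θ : sphere (0 : E3) 1, h (θ : E3) * (θ : E3) i ∂surface, fun X hX => ?_⟩
  have h1 := hw.integral_mul_dot hc hX
  have h2 : h X * m = ∫ θ, h (θ : E3) * dot X θ ∂surface := by
    rw [h1, hm, moment_eq (by simp) hX, moment]
  have h3 : ∫ θ, h (θ : E3) * dot X θ ∂surface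
      = ∑ i, X i * ∫ θ : sphere (0 : E3) 1, h (θ : E3) * (θ : E3) i ∂surface := by
    simp only [← integral_const_mul]
    rw [← integral_finsetSum]
    · refine integral_congr_ae (ae_of_all _ fun θ => ?_)
      simp only [dot, Finset.mul_sum]
      exact Finset.sum_congr rfl fun i _ => by ring
    · intro i _
      exact (integrable_surface (f := fun θ => h θ * θ i)
        (hc.mul (contDiff_coord (n := 0)).continuous.continuousOn)).const_mul _
  rw [h3] at h2
  have h4 : h X = m⁻¹ * (h X * m) := by field_simp
  rw [h4, h2, Finset.mul_sum]
  exact Finset.sum_congr rfl fun i _ => by ring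

end Rigidity

/-! ### The explicit particular solution of the limit equation. -/

section Particular

variable {x : E3}

theorem source_scale (c : ℝ) (D : Option (Fin 3) → Fin 3 → ℝ) (a : Option (Fin 3)) :
    source (c • D) a = c ^ 2 * source D a := by
  cases a with
  | none =>
    simp only [source, Pi.smul_apply, smul_eq_mul, Fin.sum_univ_three]
    ring
  | some j =>
    simp only [source, Pi.smul_apply, smul_eq_mul, Fin.sum_univ_three]
    ring

/-- The leading coefficients as one family. -/
def leading (A : ℝ) (B : Fin 3 → ℝ) : Option (Fin 3) → ℝ
  | none => A
  | some i => B i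

/-- The gradient of the leading terms `α a / ‖x‖`. -/
noncomputable def leadingGrad (α : Option (Fin 3) → ℝ) (x : E3) (a : Option (Fin 3)) (i : Fin 3) :
    ℝ := α a * (-(‖x‖⁻¹ ^ 3) * x i)

theorem source_leadingGrad_none (A : ℝ) (B : Fin 3 → ℝ) (hx : x ≠ 0) :
    source (leadingGrad (leading A B) x) none = (‖x‖ ^ 2)⁻¹ ^ 2 * (-(1 / 4) * ∑ i, B i ^ 2)
      - (‖x‖ ^ 2)⁻¹ ^ 3 * (1 / 16 * (∑ i, B i * x i) ^ 2) := by
  have h0 : ‖x‖ ≠ 0 := norm_ne_zero_iff.2 hx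
  -- Writing `r⁻⁴` as `r⁻⁶ Σ xᵢ²` gives all terms the common factor `r⁻⁶` and leaves a polynomial
  -- identity.
  have h1 : (‖x‖ ^ 2)⁻¹ ^ 2 = (‖x‖ ^ 2)⁻¹ ^ 3 * ∑ i, x i ^ 2 := by
    rw [← norm_sq_eq_sum]; field_simp
  rw [h1]
  simp only [source, leadingGrad, leading, Fin.sum_univ_three, Fin.isValue, if_true, Fin.reduceEq,
    if_false]
  ring

theorem source_leadingGrad_some (A : ℝ) (B : Fin 3 → ℝ) (hx : x ≠ 0) (j : Fin 3) :
    source (leadingGrad (leading A B) x) (some j) = (‖x‖ ^ 2)⁻¹ ^ 2 * (-4 * A * B j)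
      - (‖x‖ ^ 2)⁻¹ ^ 3 * (2 * A * (∑ i, B i * x i) * x j) := by
  have h0 : ‖x‖ ≠ 0 := norm_ne_zero_iff.2 hx
  have h1 : (‖x‖ ^ 2)⁻¹ ^ 2 = (‖x‖ ^ 2)⁻¹ ^ 3 * ∑ i, x i ^ 2 := by
    rw [← norm_sq_eq_sum]; field_simp
  rw [h1]
  fin_cases j <;>
  · simp only [source, leadingGrad, leading, Fin.sum_univ_three, Fin.isValue, if_true, Fin.reduceEq,
      if_false, Fin.zero_eta, Fin.mk_one, Fin.reduceFinMk]
    ring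

theorem zpow_neg_two : ‖x‖ ^ (-2 : ℤ) = (‖x‖ ^ 2)⁻¹ := by
  rw [zpow_neg]; norm_cast

theorem zpow_neg_four : ‖x‖ ^ (-4 : ℤ) = (‖x‖ ^ 2)⁻¹ ^ 2 := by
  rw [zpow_neg, inv_pow, ← pow_mul]; norm_cast

theorem contDiffAt_dot_mul_dot (a b : E3) (hx : x ≠ 0) :
    ContDiffAt ℝ 2 (fun y => (dot a y * dot b y) * ‖y‖ ^ (-4 : ℤ)) x :=
  ((contDiff_inner_left a).contDiffAt.mul (contDiff_inner_left b).contDiffAt).mul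
    (contDiffAt_norm_zpow hx _)

theorem lap_dot_mul_dot (a b : E3) (hx : x ≠ 0) :
    lap (fun y => (dot a y * dot b y) * ‖y‖ ^ (-4 : ℤ)) x
      = 2 * dot a b * (‖x‖ ^ 2)⁻¹ ^ 2 - 4 * (dot a x * dot b x) * (‖x‖ ^ 2)⁻¹ ^ 3 := by
  have hl : ∀ e : E3, ContDiffAt ℝ 2 (dot e) x := fun e => (contDiff_inner_left e).contDiffAt
  have hp : ∀ (e : E3) i, pd i (dot e) x = e i := fun e i => pd_linear e
  have hlap : ∀ e : E3, lap (dot e) x = 0 := fun e => lap_linear e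
  have hd : ∀ e : E3, DifferentiableAt ℝ (dot e) x := fun e =>
    (hl e).differentiableAt two_ne_zero
  rw [lap_mul ((hl a).mul (hl b)) (contDiffAt_norm_zpow hx _), lap_mul (hl a) (hl b),
    lap_norm_zpow hx]
  simp only [pd_mul (hd a) (hd b), hp, hlap, pd_norm_zpow hx]
  have h1 : ∀ i, (dot a x * b i + dot b x * a i)
      * (((-4 : ℤ) : ℝ) * ‖x‖ ^ (-4 : ℤ) * (‖x‖ ^ 2)⁻¹ * x i)
      = -4 * ‖x‖ ^ (-4 : ℤ) * (‖x‖ ^ 2)⁻¹ * dot a x * (b i * x i)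
        + -4 * ‖x‖ ^ (-4 : ℤ) * (‖x‖ ^ 2)⁻¹ * dot b x * (a i * x i) := fun i => by
    push_cast; ring
  simp only [h1, Finset.sum_add_distrib, ← Finset.mul_sum]
  simp only [← dot.eq_1, zpow_neg_four]
  push_cast
  ring

/-- The explicit second-order coefficients, up to first-order harmonics. -/
noncomputable def particular (A : ℝ) (B : Fin 3 → ℝ) : Option (Fin 3) → E3 → ℝ
  | none => fun X => -(9 / 64) * ∑ i, B i ^ 2 + 1 / 64 * (∑ i, B i * X i) ^ 2
  | some i => fun X => A * (-(5 / 2) * B i + 1 / 2 * (∑ l, B l * X l) * X i)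

theorem continuous_particular (A : ℝ) (B : Fin 3 → ℝ) (a : Option (Fin 3)) :
    Continuous (particular A B a) := by
  cases a <;> (simp only [particular]; fun_prop)

theorem dot_single (i : Fin 3) (y : E3) : dot (EuclideanSpace.single i 1) y = y i := by
  simp [dot]

theorem particular_none_eq (A : ℝ) (B : Fin 3 → ℝ) (x : E3) :
    particular A B none (‖x‖⁻¹ • x) / ‖x‖ ^ 2 = -(9 / 64) * (∑ i, B i ^ 2) * ‖x‖ ^ (-2 : ℤ)
      + 1 / 64 * ((dot (WithLp.toLp 2 B) x * dot (WithLp.toLp 2 B) x) * ‖x‖ ^ (-4 : ℤ)) := by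
  have h1 : ∑ i, B i * (‖x‖⁻¹ • x) i = ‖x‖⁻¹ * dot (WithLp.toLp 2 B) x := dot_smul _ _ _
  simp only [particular, h1, zpow_neg_two, zpow_neg_four]
  ring

theorem particular_some_eq (A : ℝ) (B : Fin 3 → ℝ) (i : Fin 3) (x : E3) :
    particular A B (some i) (‖x‖⁻¹ • x) / ‖x‖ ^ 2 = -(5 / 2) * A * B i * ‖x‖ ^ (-2 : ℤ)
      + 1 / 2 * A * ((dot (WithLp.toLp 2 B) x * dot (EuclideanSpace.single i 1) x)
        * ‖x‖ ^ (-4 : ℤ)) := by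
  have h1 : ∑ i, B i * (‖x‖⁻¹ • x) i = ‖x‖⁻¹ * dot (WithLp.toLp 2 B) x := dot_smul _ _ _
  simp only [particular, h1, zpow_neg_two, zpow_neg_four, dot_single]
  simp
  ring

/-- The Laplacian preserves the span of `r⁻²` and `(a·x)(b·x)r⁻⁴` up to a factor `r⁻²`, so the
coefficients solve a triangular system. For `u`: `-4·(1/64) = -1/16` and `2·(-9/64) + 2/64 = -1/4`.
For `Y`: `-4·(1/2) = -2` and `2·(-5/2) + 2·(1/2) = -4`, times `A`. -/
theorem particular_spec (A : ℝ) (B : Fin 3 → ℝ) (a : Option (Fin 3)) (hx : x ≠ 0) :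
    ContDiffAt ℝ 2 (fun y => particular A B a (‖y‖⁻¹ • y) / ‖y‖ ^ 2) x ∧
      lap (fun y => particular A B a (‖y‖⁻¹ • y) / ‖y‖ ^ 2) x
        = source (leadingGrad (leading A B) x) a := by
  have hz := contDiffAt_norm_zpow hx (-2)
  cases a with
  | none =>
    have he : (fun y => particular A B none (‖y‖⁻¹ • y) / ‖y‖ ^ 2) =ᶠ[𝓝 x] fun y =>
        -(9 / 64) * (∑ i, B i ^ 2) * ‖y‖ ^ (-2 : ℤ) + 1 / 64 *
          ((dot (WithLp.toLp 2 B) y * dot (WithLp.toLp 2 B) y) * ‖y‖ ^ (-4 : ℤ)) := by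
      exact Eventually.of_forall fun y => particular_none_eq A B y
    have hc1 := contDiffAt_const (c := -(9 / 64) * (∑ i, B i ^ 2)).mul hz
    have hc2 := contDiffAt_const (c := (1 / 64 : ℝ)).mul
      (contDiffAt_dot_mul_dot (WithLp.toLp 2 B) (WithLp.toLp 2 B) hx)
    refine ⟨(hc1.add hc2).congr_of_eventuallyEq he, ?_⟩
    rw [lap_congr he, lap_add hc1 hc2, lap_const_mul, lap_const_mul, lap_norm_zpow hx,
      lap_dot_mul_dot _ _ hx, source_leadingGrad_none A B hx, zpow_neg_two, dot_self,
      norm_sq_eq_sum (WithLp.toLp 2 B)]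
    simp only [dot]
    push_cast
    ring
  | some i =>
    have he : (fun y => particular A B (some i) (‖y‖⁻¹ • y) / ‖y‖ ^ 2) =ᶠ[𝓝 x] fun y =>
        -(5 / 2) * A * B i * ‖y‖ ^ (-2 : ℤ) + 1 / 2 * A *
          ((dot (WithLp.toLp 2 B) y * dot (EuclideanSpace.single i 1) y) * ‖y‖ ^ (-4 : ℤ)) := by
      exact Eventually.of_forall fun y => particular_some_eq A B i y
    have hc1 := contDiffAt_const (c := -(5 / 2) * A * B i).mul hz
    have hc2 := contDiffAt_const (c := 1 / 2 * A).mul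
      (contDiffAt_dot_mul_dot (WithLp.toLp 2 B) (EuclideanSpace.single i 1) hx)
    refine ⟨(hc1.add hc2).congr_of_eventuallyEq he, ?_⟩
    rw [lap_congr he, lap_add hc1 hc2, lap_const_mul, lap_const_mul, lap_norm_zpow hx,
      lap_dot_mul_dot _ _ hx, source_leadingGrad_some A B hx, zpow_neg_two, dot_single,
      dot_comm, dot_single]
    simp only [dot]
    push_cast
    ring

theorem integral_particular (A : ℝ) (B : Fin 3 → ℝ) (a : Option (Fin 3)) {φ : E3 → ℝ}
    (hφ : ContDiff ℝ 2 φ) (hs : tsupport φ ⊆ shell) :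
    ∫ x, particular A B a (‖x‖⁻¹ • x) / ‖x‖ ^ 2 * lap φ x
      = ∫ x, φ x * source (leadingGrad (leading A B) x) a := by
  rw [integral_mul_lap isOpen_compl_singleton hφ (hasCompactSupport_of_shell hs)
    (fun x hx => ne_zero_of_mem_shell (hs hx))
    (fun x hx => (particular_spec A B a hx).1.contDiffWithinAt)]
  refine integral_congr_ae (ae_of_all _ fun x => ?_)
  by_cases hx : x ∈ tsupport φ
  · simp only [(particular_spec A B a (ne_zero_of_mem_shell (hs hx))).2]
  · simp [image_eq_zero_of_notMem_tsupport hx]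

end Particular

/-! ### Stability of the quadratic source under perturbation of the gradient. -/

section QuadraticBound

variable {V : Type*} [NormedAddCommGroup V] {F G : V → ℝ}

/-- The Lipschitz-type estimate satisfied by quadratic forms. -/
def QuadraticBound (F : V → ℝ) : Prop :=
  ∃ C, 0 ≤ C ∧ ∀ d z, |F (d + z) - F d| ≤ C * (‖d‖ * ‖z‖ + ‖z‖ ^ 2)

theorem quadraticBound_mul [NormedSpace ℝ V] (l₁ l₂ : V →L[ℝ] ℝ) : QuadraticBound fun z => l₁ z * l₂ z := by
  refine ⟨2 * (‖l₁‖ * ‖l₂‖), by positivity, fun d z => ?_⟩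
  have h1 := l₁.le_opNorm
  have h2 := l₂.le_opNorm
  simp only [Real.norm_eq_abs] at h1 h2
  have e : l₁ (d + z) * l₂ (d + z) - l₁ d * l₂ d = l₁ d * l₂ z + l₁ z * l₂ d + l₁ z * l₂ z := by
    simp only [map_add]; ring
  rw [e]
  calc |l₁ d * l₂ z + l₁ z * l₂ d + l₁ z * l₂ z|
      ≤ |l₁ d| * |l₂ z| + |l₁ z| * |l₂ d| + |l₁ z| * |l₂ z| := by
        rw [← abs_mul, ← abs_mul, ← abs_mul]
        exact (abs_add_le _ _).trans (add_le_add_left (abs_add_le _ _) _)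
    _ ≤ (‖l₁‖ * ‖d‖) * (‖l₂‖ * ‖z‖) + (‖l₁‖ * ‖z‖) * (‖l₂‖ * ‖d‖)
        + (‖l₁‖ * ‖z‖) * (‖l₂‖ * ‖z‖) := by
        gcongr <;> first | exact h1 _ | exact h2 _
    _ ≤ _ := by nlinarith [mul_nonneg (mul_nonneg (norm_nonneg l₁) (norm_nonneg l₂)) (sq_nonneg ‖z‖)]

theorem QuadraticBound.add (hF : QuadraticBound F) (hG : QuadraticBound G) :
    QuadraticBound fun z => F z + G z := by
  obtain ⟨C, hC, h⟩ := hF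
  obtain ⟨C', hC', h'⟩ := hG
  refine ⟨C + C', by positivity, fun d z => ?_⟩
  calc |F (d + z) + G (d + z) - (F d + G d)|
      = |(F (d + z) - F d) + (G (d + z) - G d)| := by ring_nf
    _ ≤ _ := (abs_add_le _ _).trans (by linarith [h d z, h' d z])

theorem QuadraticBound.const_mul (c : ℝ) (hF : QuadraticBound F) :
    QuadraticBound fun z => c * F z := by
  obtain ⟨C, hC, h⟩ := hF
  refine ⟨|c| * C, by positivity, fun d z => ?_⟩
  rw [← mul_sub, abs_mul, mul_assoc]
  gcongr
  exact h d z

theorem QuadraticBound.sum {ι : Type*} (s : Finset ι) {F : ι → V → ℝ}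
    (h : ∀ i ∈ s, QuadraticBound (F i)) : QuadraticBound fun z => ∑ i ∈ s, F i z := by
  classical
  induction s using Finset.induction_on with
  | empty => exact ⟨0, le_rfl, by simp⟩
  | insert i s hi ih =>
    simp only [Finset.sum_insert hi]
    exact (h i (Finset.mem_insert_self i s)).add
      (ih fun j hj => h j (Finset.mem_insert_of_mem hj))

theorem quadraticBound_source (a : Option (Fin 3)) :
    QuadraticBound fun D : Option (Fin 3) → Fin 3 → ℝ => source D a := by
  let π : Option (Fin 3) → Fin 3 → (Option (Fin 3) → Fin 3 → ℝ) →L[ℝ] ℝ := fun a i =>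
    (ContinuousLinearMap.proj (R := ℝ) (φ := fun _ : Fin 3 => ℝ) i).comp
      (ContinuousLinearMap.proj (R := ℝ) (φ := fun _ : Option (Fin 3) => Fin 3 → ℝ) a)
  let div : (Option (Fin 3) → Fin 3 → ℝ) →L[ℝ] ℝ := ∑ l, π (some l) l
  -- `c = 1/2` is the bracket of `k` in the Hamiltonian constraint, `c = 1` its trace-adjusted
  -- version in the momentum constraint.
  let K : ℝ → Fin 3 → Fin 3 → (Option (Fin 3) → Fin 3 → ℝ) →L[ℝ] ℝ := fun c i j =>
    π (some i) j + π (some j) i - (c * (if i = j then 1 else 0)) • div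
  have hπ : ∀ a i D, π a i D = D a i := fun _ _ _ => rfl
  have hdiv : ∀ D, div D = ∑ l, D (some l) l := fun D => by
    simp [div, hπ]
  have hK : ∀ c i j D, K c i j D = D (some i) j + D (some j) i
      - c * (if i = j then 1 else 0) * ∑ l, D (some l) l := fun c i j D => by
    simp only [K, sub_apply, add_apply, smul_apply, hπ, hdiv, smul_eq_mul]
  cases a with
  | none =>
    have h := (((quadraticBound_mul div div).const_mul (1 / 4)).add
      ((QuadraticBound.sum Finset.univ fun i _ => QuadraticBound.sum Finset.univ fun j _ =>
        quadraticBound_mul (K (1 / 2) i j) (K (1 / 2) i j)).const_mul (-1))).const_mul (1 / 8)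
    convert h using 2 with D
    simp only [source, hdiv, hK, Fin.sum_univ_three]
    ring
  | some j =>
    have h := ((QuadraticBound.sum Finset.univ fun m _ =>
        quadraticBound_mul (π none m) (K 1 m j)).const_mul (-4)).add
      ((quadraticBound_mul (π none j) div).const_mul (-2))
    convert h using 2 with D
    simp only [source, hdiv, hK, hπ, Fin.sum_univ_three]
    ring

end QuadraticBound

/-! ### Blow-down of the unknowns at infinity. -/

section Rescaling

variable {f f₂ : E3 → ℝ} {a₀ a₁ R : ℝ}

/-- The remainder after the leading term of the blow-down of `f - a₀`. -/
noncomputable def rescaled (f : E3 → ℝ) (a₀ a₁ ρ : ℝ) (x : E3) : ℝ :=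
  ρ * (f (ρ • x) - a₀) - a₁ * ‖x‖ ^ (-1 : ℤ)

theorem HasExpansion.tendstoUniformlyOn (h : HasExpansion f a₀ a₁ f₂) :
    TendstoUniformlyOn (fun ρ x => ρ * rescaled f a₀ a₁ ρ x)
      (fun x => f₂ (‖x‖⁻¹ • x) / ‖x‖ ^ 2) atTop {x | 1 ≤ ‖x‖} := by
  rw [Metric.tendstoUniformlyOn_iff]
  intro ε hε
  have h1 := h.def (half_pos hε)
  obtain ⟨M, -, hM⟩ := (hasBasis_cobounded_norm (E := E3)).eventually_iff.1 h1
  filter_upwards [eventually_ge_atTop M, eventually_gt_atTop 0] with ρ hρM hρ x hx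
  have hx1 : 1 ≤ ‖x‖ := hx
  have hx0 : 0 < ‖x‖ := by linarith
  have hn : ‖ρ • x‖ = ρ * ‖x‖ := by rw [norm_smul, Real.norm_eq_abs, abs_of_pos hρ]
  have h2 := hM (x := ρ • x) (show M ≤ ‖ρ • x‖ by rw [hn]; nlinarith)
  have hdir : ‖ρ • x‖⁻¹ • ρ • x = ‖x‖⁻¹ • x := by
    rw [hn, smul_smul]; congr 1; field_simp
  rw [hdir, hn, Real.norm_eq_abs, Real.norm_eq_abs,
    abs_of_pos (by positivity : 0 < 1 / (ρ * ‖x‖) ^ 2)] at h2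
  have h3 : ρ * rescaled f a₀ a₁ ρ x - f₂ (‖x‖⁻¹ • x) / ‖x‖ ^ 2
      = ρ ^ 2 * (f (ρ • x) - (a₀ + a₁ / (ρ * ‖x‖) + f₂ (‖x‖⁻¹ • x) / (ρ * ‖x‖) ^ 2)) := by
    rw [rescaled, zpow_neg_one]
    field_simp
    ring
  rw [dist_comm, Real.dist_eq, h3, abs_mul, abs_of_pos (by positivity : 0 < ρ ^ 2)]
  calc ρ ^ 2 * |f (ρ • x) - (a₀ + a₁ / (ρ * ‖x‖) + f₂ (‖x‖⁻¹ • x) / (ρ * ‖x‖) ^ 2)|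
      ≤ ρ ^ 2 * (ε / 2 * (1 / (ρ * ‖x‖) ^ 2)) := by gcongr
    _ = ε / 2 / ‖x‖ ^ 2 := by field_simp
    _ ≤ ε / 2 / 1 := by gcongr; nlinarith
    _ < ε := by linarith

theorem smul_mem_exterior {ρ : ℝ} {x : E3} (hρ0 : 0 < ρ) (hρ : R < ρ) (hx : 1 ≤ ‖x‖) :
    ρ • x ∈ exterior R := by
  change R < ‖ρ • x‖
  rw [norm_smul, Real.norm_eq_abs, abs_of_pos hρ0]
  nlinarith

theorem ne_zero_of_one_le_norm {x : E3} (hx : 1 ≤ ‖x‖) : x ≠ 0 := by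
  rintro rfl
  norm_num at hx

theorem contDiffAt_comp_smul {ρ : ℝ} {x : E3} (hf : ContDiffAt ℝ 2 f (ρ • x)) :
    ContDiffAt ℝ 2 (fun y => f (ρ • y)) x :=
  hf.comp (f := fun y : E3 => ρ • y) x (contDiff_const_smul ρ).contDiffAt

theorem contDiffAt_rescaled {ρ : ℝ} {x : E3} (hx : x ≠ 0) (hf : ContDiffAt ℝ 2 f (ρ • x)) :
    ContDiffAt ℝ 2 (rescaled f a₀ a₁ ρ) x :=
  (contDiffAt_const.mul ((contDiffAt_comp_smul hf).sub contDiffAt_const)).sub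
    (contDiffAt_const.mul (contDiffAt_norm_zpow hx _))

theorem pd_rescaled {ρ : ℝ} {x : E3} (hx : x ≠ 0) (hf : ContDiffAt ℝ 2 f (ρ • x)) (i : Fin 3) :
    pd i (rescaled f a₀ a₁ ρ) x = ρ ^ 2 * pd i f (ρ • x) - a₁ * (-(‖x‖⁻¹ ^ 3) * x i) := by
  have h1 := contDiffAt_comp_smul hf
  have h2 := contDiffAt_norm_zpow hx (-1)
  have e : rescaled f a₀ a₁ ρ = fun x => ρ * (f (ρ • x) - a₀) - a₁ * ‖x‖ ^ (-1 : ℤ) := rfl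
  have hd1 := h1.differentiableAt two_ne_zero
  rw [e, pd_sub ((differentiableAt_const _).fun_mul (hd1.fun_sub (differentiableAt_const _)))
    ((differentiableAt_const _).fun_mul (h2.differentiableAt two_ne_zero)), pd_const_mul,
    pd_const_mul, pd_sub hd1 (differentiableAt_const _), pd_const, pd_comp_smul, pd_norm_zpow hx,
    zpow_neg_one]
  push_cast
  ring

/-- The subtracted leading term `a₁/|x|` is harmonic, so it does not contribute. -/
theorem lap_rescaled {ρ : ℝ} {x : E3} (hx : x ≠ 0) (hf : ContDiffAt ℝ 2 f (ρ • x)) :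
    lap (rescaled f a₀ a₁ ρ) x = ρ ^ 3 * lap f (ρ • x) := by
  have h1 := contDiffAt_comp_smul hf
  have h2 := contDiffAt_norm_zpow hx (-1)
  have e : rescaled f a₀ a₁ ρ = fun x => ρ * (f (ρ • x) - a₀) - a₁ * ‖x‖ ^ (-1 : ℤ) := rfl
  rw [e, lap_sub (contDiffAt_const.mul (h1.sub contDiffAt_const)) (contDiffAt_const.mul h2),
    lap_const_mul, lap_const_mul, lap_sub h1 contDiffAt_const, lap_const, lap_comp_smul,
    lap_norm_zpow hx]
  push_cast
  ring

/-- No regularity of `f₂` is assumed; it is continuous on the sphere as a locally uniform limit of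
the rescaled remainders. -/
theorem HasExpansion.continuousOn (h : HasExpansion f a₀ a₁ f₂)
    (hf : ContDiffOn ℝ 2 f (exterior R)) : ContinuousOn f₂ (sphere 0 1) := by
  have h1 : ContinuousOn (fun x => f₂ (‖x‖⁻¹ • x) / ‖x‖ ^ 2) {x : E3 | 1 ≤ ‖x‖} := by
    refine h.tendstoUniformlyOn.continuousOn (Eventually.frequently ?_)
    filter_upwards [eventually_gt_atTop 0, eventually_gt_atTop R] with ρ h0 hR x hx
    exact (continuousAt_const.mul (contDiffAt_rescaled (ne_zero_of_one_le_norm hx)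
      (hf.contDiffAt ((isOpen_exterior R).mem_nhds
        (smul_mem_exterior h0 hR hx)))).continuousAt).continuousWithinAt
  refine (h1.mono fun x hx => (mem_sphere_zero_iff_norm.1 hx).ge).congr fun x hx => ?_
  simp [mem_sphere_zero_iff_norm.1 hx]

theorem HasExpansion.exists_bound (h : HasExpansion f a₀ a₁ f₂)
    (hf : ContDiffOn ℝ 2 f (exterior R)) :
    ∃ C, 0 ≤ C ∧ ∀ᶠ ρ in atTop, ∀ x : E3, 1 ≤ ‖x‖ → |ρ * rescaled f a₀ a₁ ρ x| ≤ C := by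
  obtain ⟨M, hM⟩ := (isCompact_sphere (0 : E3) 1).exists_bound_of_continuousOn (h.continuousOn hf)
  refine ⟨|M| + 1, by positivity, ?_⟩
  filter_upwards [Metric.tendstoUniformlyOn_iff.1 h.tendstoUniformlyOn 1 one_pos] with ρ hρ x hx
  have h1 := hρ x hx
  rw [dist_comm, Real.dist_eq] at h1
  have h2 : |f₂ (‖x‖⁻¹ • x) / ‖x‖ ^ 2| ≤ |M| := by
    have h3 := hM _ (norm_inv_smul_mem_sphere (ne_zero_of_one_le_norm hx))
    rw [Real.norm_eq_abs] at h3
    rw [abs_div, abs_of_nonneg (sq_nonneg ‖x‖)]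
    calc |f₂ (‖x‖⁻¹ • x)| / ‖x‖ ^ 2 ≤ |f₂ (‖x‖⁻¹ • x)| / 1 := by
          gcongr; exact one_le_pow₀ hx
      _ ≤ |M| := by rw [div_one]; exact h3.trans (le_abs_self M)
  have h4 := abs_sub_abs_le_abs_sub (ρ * rescaled f a₀ a₁ ρ x) (f₂ (‖x‖⁻¹ • x) / ‖x‖ ^ 2)
  linarith

theorem isOpen_one_lt_norm : IsOpen {x : E3 | 1 < ‖x‖} := isOpen_lt continuous_const continuous_norm

/-- Passage to the limit in the distributional Laplacian of the rescaled remainder. -/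
theorem HasExpansion.tendsto_integral (h : HasExpansion f a₀ a₁ f₂)
    (hf : ContDiffOn ℝ 2 f (exterior R)) {ψ : E3 → ℝ} (hψ : Continuous ψ)
    (hs : tsupport ψ ⊆ shell) :
    Tendsto (fun ρ => ∫ x, ρ * rescaled f a₀ a₁ ρ x * ψ x) atTop
      (𝓝 (∫ x, f₂ (‖x‖⁻¹ • x) / ‖x‖ ^ 2 * ψ x)) := by
  have hcs := hasCompactSupport_of_shell hs
  have hsh : ∀ x ∈ tsupport ψ, 1 < ‖x‖ := fun x hx => by
    nlinarith [(hs hx).1, norm_nonneg x]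
  obtain ⟨C, hC0, hC⟩ := h.exists_bound hf
  refine tendsto_integral_filter_of_dominated_convergence (fun x => C * |ψ x|) ?_ ?_ ?_ ?_
  · filter_upwards [eventually_gt_atTop 0, eventually_gt_atTop R] with ρ h0 hR
    have hc : ContinuousOn (fun x => ρ * rescaled f a₀ a₁ ρ x) {x : E3 | 1 < ‖x‖} :=
      fun x (hx : 1 < ‖x‖) => (continuousAt_const.mul (contDiffAt_rescaled
        (ne_zero_of_one_le_norm hx.le) (hf.contDiffAt ((isOpen_exterior R).mem_nhds
          (smul_mem_exterior h0 hR hx.le)))).continuousAt).continuousWithinAt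
    have := integrable_mul_of_tsupport isOpen_one_lt_norm hψ hcs hsh hc
    simpa only [mul_comm (ψ _)] using this.aestronglyMeasurable
  · filter_upwards [hC] with ρ hρ
    refine ae_of_all _ fun x => ?_
    rw [Real.norm_eq_abs, abs_mul]
    by_cases hx : x ∈ tsupport ψ
    · exact mul_le_mul_of_nonneg_right (hρ x (hsh x hx).le) (abs_nonneg _)
    · simp [image_eq_zero_of_notMem_tsupport hx]
  · exact (hψ.integrable_of_hasCompactSupport hcs).abs.const_mul C
  · refine ae_of_all _ fun x => ?_
    by_cases hx : x ∈ tsupport ψ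
    · exact (h.tendstoUniformlyOn.tendsto_at (show 1 ≤ ‖x‖ from (hsh x hx).le)).mul_const _
    · simp [image_eq_zero_of_notMem_tsupport hx]

end Rescaling

/-- A smooth cutoff equal to one on the shell. -/
noncomputable def shellCutoff : ContDiffBump (4 : ℝ) := ⟨2, 5 / 2, two_pos, by norm_num⟩

theorem contDiff_shellCutoff : ContDiff ℝ 2 fun x : E3 => shellCutoff (‖x‖ ^ 2) :=
  (shellCutoff.contDiff (n := 2)).comp contDiff_normSq

theorem tsupport_shellCutoff :
    tsupport (fun x : E3 => shellCutoff (‖x‖ ^ 2)) ⊆ {x | 3 / 2 ≤ ‖x‖ ^ 2 ∧ ‖x‖ ^ 2 ≤ 13 / 2} := by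
  have hc : Continuous fun x : E3 => ‖x‖ ^ 2 := by fun_prop
  refine closure_minimal (fun x hx => ?_)
    ((isClosed_le continuous_const hc).inter (isClosed_le hc continuous_const))
  have h : ‖x‖ ^ 2 ∈ Function.support shellCutoff := hx
  rw [shellCutoff.support_eq, Metric.mem_ball, Real.dist_eq, abs_lt] at h
  simp only [shellCutoff] at h
  exact ⟨by linarith, by linarith⟩

theorem hasCompactSupport_shellCutoff : HasCompactSupport fun x : E3 => shellCutoff (‖x‖ ^ 2) := by
  refine (isCompact_closedBall (0 : E3) 7).of_isClosed_subset (isClosed_tsupport _) fun x hx => ?_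
  rw [mem_closedBall_zero_iff]
  nlinarith [(tsupport_shellCutoff hx).2, norm_nonneg x]

/-- A test function may change sign, whereas Caccioppoli's inequality needs a nonnegative weight;
the cutoff is `1` on the shell and so dominates `φ` up to a constant. -/
theorem exists_abs_le_shellCutoff {φ : E3 → ℝ} (hφ : Continuous φ) (hs : tsupport φ ⊆ shell) :
    ∃ K, ∀ x, |φ x| ≤ K * shellCutoff (‖x‖ ^ 2) := by
  obtain ⟨K, hK⟩ := hφ.bounded_above_of_compact_support (hasCompactSupport_of_shell hs)
  have hK0 : 0 ≤ K := (norm_nonneg _).trans (hK 0)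
  refine ⟨K, fun x => ?_⟩
  by_cases hx : x ∈ tsupport φ
  · have h1 : shellCutoff (‖x‖ ^ 2) = 1 := by
      refine shellCutoff.one_of_mem_closedBall ?_
      rw [mem_closedBall, Real.dist_eq, abs_le]
      simp only [shellCutoff]
      constructor <;> linarith [(hs hx).1, (hs hx).2]
    rw [h1, mul_one]
    exact hK x
  · rw [image_eq_zero_of_notMem_tsupport hx, abs_zero]
    exact mul_nonneg hK0 shellCutoff.nonneg

/-! ### The limit equation for the second-order coefficients. -/

section Main

variable {R : ℝ} {g k : Tensor2} {u : E3 → ℝ} {Y : Fin 3 → E3 → ℝ} {A : ℝ} {B : Fin 3 → ℝ}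
  {F : Option (Fin 3) → E3 → ℝ}

/-- The values of the unknowns at infinity. -/
def limitValue : Option (Fin 3) → ℝ
  | none => 1
  | some _ => 0

/-- The coefficient multiplying `source` in the equation for each unknown. -/
noncomputable def weight (u : E3 → ℝ) : Option (Fin 3) → E3 → ℝ
  | none => u
  | some _ => fun x => (u x)⁻¹

theorem HarmonicAsymptotics.contDiffOn_unknown (h : HarmonicAsymptotics R g k u Y)
    (a : Option (Fin 3)) : ContDiffOn ℝ 2 (unknown u Y a) (exterior R) := by
  cases a with
  | none => exact h.contDiff_u
  | some i => exact h.contDiff_Y i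

theorem HarmonicAsymptotics.lap_unknown (h : HarmonicAsymptotics R g k u Y)
    (hV : VacuumConstraint g k (exterior R)) {x : E3} (hx : x ∈ exterior R) (a : Option (Fin 3)) :
    lap (unknown u Y a) x
      = weight u a x * source (fun b i => pd i (unknown u Y b) x) a := by
  cases a with
  | none => exact h.lap_u hV hx
  | some i => exact h.lap_Y hV hx i

theorem norm_leadingGrad_le (α : Option (Fin 3) → ℝ) {x : E3} (hx : 1 ≤ ‖x‖) :
    ‖leadingGrad α x‖ ≤ ∑ a, |α a| := by
  have hS : 0 ≤ ∑ a, |α a| := Finset.sum_nonneg fun _ _ => abs_nonneg _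
  rw [pi_norm_le_iff_of_nonneg hS]
  intro a
  rw [pi_norm_le_iff_of_nonneg hS]
  intro i
  have h1 : ‖x i‖ ≤ ‖x‖ := PiLp.norm_apply_le x i
  have h2 : ‖x‖⁻¹ ^ 3 * ‖x i‖ ≤ 1 := by
    have h3 : ‖x‖⁻¹ ≤ 1 := inv_le_one_of_one_le₀ hx
    have h0 : ‖x‖ ≠ 0 := by positivity
    calc ‖x‖⁻¹ ^ 3 * ‖x i‖ ≤ ‖x‖⁻¹ ^ 3 * ‖x‖ := by gcongr
      _ = ‖x‖⁻¹ ^ 2 := by field_simp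
      _ ≤ 1 := pow_le_one₀ (by positivity) h3
  calc ‖leadingGrad α x a i‖ = |α a| * (‖x‖⁻¹ ^ 3 * ‖x i‖) := by
        simp [leadingGrad]
    _ ≤ |α a| * 1 := by gcongr
    _ ≤ ∑ a, |α a| := by
        rw [mul_one]
        exact Finset.single_le_sum (f := fun a => |α a|) (fun _ _ => abs_nonneg _)
          (Finset.mem_univ a)

theorem norm_grad_le {ι : Type*} [Fintype ι] (v : ι → E3 → ℝ) (x : E3) :
    ‖fun a i => pd i (v a) x‖ ≤ √(gradSq v x) := by
  rw [pi_norm_le_iff_of_nonneg (Real.sqrt_nonneg _)]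
  intro a
  rw [pi_norm_le_iff_of_nonneg (Real.sqrt_nonneg _)]
  intro i
  refine Real.le_sqrt_of_sq_le ?_
  rw [Real.norm_eq_abs, sq_abs]
  calc pd i (v a) x ^ 2 ≤ ∑ j, pd j (v a) x ^ 2 :=
        Finset.single_le_sum (f := fun j => pd j (v a) x ^ 2) (fun _ _ => sq_nonneg _)
          (Finset.mem_univ i)
    _ ≤ gradSq v x := Finset.single_le_sum (f := fun a => ∑ j, pd j (v a) x ^ 2)
          (fun _ _ => Finset.sum_nonneg fun _ _ => sq_nonneg _) (Finset.mem_univ a)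

/-- The second-order coefficients satisfy the limit equation in the sense of distributions. -/
theorem HarmonicAsymptotics.integral_second_order (h : HarmonicAsymptotics R g k u Y)
    (hV : VacuumConstraint g k (exterior R)) {α : Option (Fin 3) → ℝ}
    (hE : ∀ a, HasExpansion (unknown u Y a) (limitValue a) (α a) (F a)) (a : Option (Fin 3))
    {φ : E3 → ℝ} (hφ : ContDiff ℝ 2 φ) (hs : tsupport φ ⊆ shell) :
    ∫ x, F a (‖x‖⁻¹ • x) / ‖x‖ ^ 2 * lap φ x = ∫ x, φ x * source (leadingGrad α x) a := by
  set v : ℝ → Option (Fin 3) → E3 → ℝ := fun ρ a =>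
    rescaled (unknown u Y a) (limitValue a) (α a) ρ with hvdef
  set L := ∑ a, |α a| with hL
  have hL0 : 0 ≤ L := Finset.sum_nonneg fun _ _ => abs_nonneg _
  choose Cv hCv0 hCv using fun a => (hE a).exists_bound (h.contDiffOn_unknown a)
  choose Cs hCs0 hCs' using quadraticBound_source
  have hCs : ∀ a d z, |source (d + z) a - source d a| ≤ Cs a * (‖d‖ * ‖z‖ + ‖z‖ ^ 2) := hCs'
  set C₁ := ∑ a, Cv a with hC₁
  set C₂ := ∑ a, Cs a with hC₂
  have hC₁0 : 0 ≤ C₁ := Finset.sum_nonneg fun a _ => hCv0 a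
  have hC₂0 : 0 ≤ C₂ := Finset.sum_nonneg fun a _ => hCs0 a
  have hle₁ : ∀ a, Cv a ≤ C₁ := fun a =>
    Finset.single_le_sum (f := Cv) (fun a _ => hCv0 a) (Finset.mem_univ a)
  have hle₂ : ∀ a, Cs a ≤ C₂ := fun a =>
    Finset.single_le_sum (f := Cs) (fun a _ => hCs0 a) (Finset.mem_univ a)
  have hsrc : ∀ b, ∀ x : E3, 1 ≤ ‖x‖ → |source (leadingGrad α x) b| ≤ C₂ * L ^ 2 := by
    intro b x hx
    have h1 := hCs b 0 (leadingGrad α x)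
    have h2 : source (0 : Option (Fin 3) → Fin 3 → ℝ) b = 0 := by
      have := source_scale 0 0 b
      simpa using this
    rw [zero_add, h2, sub_zero, norm_zero, zero_mul, zero_add] at h1
    have h3 := norm_leadingGrad_le α hx
    calc _ ≤ Cs b * ‖leadingGrad α x‖ ^ 2 := h1
      _ ≤ C₂ * L ^ 2 := by gcongr; exact hle₂ b
  -- The first summand bounds `ρ v_ρ`, the second the limit source and the error from the weight,
  -- the third the terms linear and quadratic in `∇v_ρ`.
  set C := C₁ + C₂ * L ^ 2 + 2 * C₂ * (L + 1) with hC
  have hC0 : 0 ≤ C := by positivity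
  have hle₃ : 0 ≤ C₂ * L ^ 2 := by positivity
  have hle₄ : 0 ≤ 2 * C₂ * (L + 1) := by positivity
  have hsubχ : tsupport (fun x : E3 => shellCutoff (‖x‖ ^ 2)) ⊆ {x | 1 < ‖x‖} := fun x hx => by
    have h1 := (tsupport_shellCutoff hx).1
    change 1 < ‖x‖
    nlinarith [norm_nonneg x]
  have hsubφ : tsupport φ ⊆ {x | 1 < ‖x‖} := fun x hx => by
    have h1 := (hs hx).1
    change 1 < ‖x‖
    nlinarith [norm_nonneg x]
  obtain ⟨K, hK⟩ := exists_abs_le_shellCutoff hφ.continuous hs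
  have hδ : Tendsto (fun ρ : ℝ => 2 * ((C₁ + L) / ρ)) atTop (𝓝 0) := by
    have : Tendsto (fun ρ : ℝ => (C₁ + L) / ρ) atTop (𝓝 0) :=
      tendsto_const_nhds.div_atTop tendsto_id
    simpa using this.const_mul 2
  have hQ : ∀ b, ContinuousOn (fun x => source (leadingGrad α x) b) {x : E3 | 1 < ‖x‖} := by
    intro b
    have hlg : ∀ c i, ContinuousOn (fun x => leadingGrad α x c i) {x : E3 | 1 < ‖x‖} := by
      intro c i
      have hinv : ContinuousOn (fun x : E3 => ‖x‖⁻¹) {x : E3 | 1 < ‖x‖} :=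
        continuous_norm.continuousOn.inv₀ fun x (hx : 1 < ‖x‖) => by positivity
      exact continuousOn_const.mul ((hinv.pow 3).neg.mul
        (contDiff_coord (n := 0)).continuous.continuousOn)
    cases b <;> (simp only [source]; fun_prop)
  have hlim := tendsto_integral_lap isOpen_one_lt_norm contDiff_shellCutoff
    hasCompactSupport_shellCutoff hsubχ (fun x => shellCutoff.nonneg) hφ
    (hasCompactSupport_of_shell hs) hsubφ hK (v := v)
    (Q := fun b x => source (leadingGrad α x) b) hC0 hδ hQ
    (fun b x hx => (hsrc b x (le_of_lt hx)).trans (by rw [hC]; linarith))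
    (by
      have hbd : ∀ᶠ ρ in atTop, ∀ b, ∀ x : E3, 1 ≤ ‖x‖ → |ρ * v ρ b x| ≤ Cv b :=
        eventually_all.2 hCv
      -- This forces `u ≥ 1/2` at the rescaled points, so both weights `u` and `u⁻¹` are within
      -- `2(C₁ + L)/ρ` of `1`.
      have hhalf : ∀ᶠ ρ : ℝ in atTop, 2 * ((C₁ + L) / ρ) ≤ 1 := hδ.eventually_le_const one_pos
      filter_upwards [hbd, hhalf, eventually_ge_atTop 1, eventually_gt_atTop R]
        with ρ hρ hρ2 hρ1 hρR b
      have hρ0 : 0 < ρ := by linarith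
      have hcd : ∀ b, ∀ x : E3, 1 ≤ ‖x‖ → ContDiffAt ℝ 2 (unknown u Y b) (ρ • x) :=
        fun b x hx => (h.contDiffOn_unknown b).contDiffAt
          ((isOpen_exterior R).mem_nhds (smul_mem_exterior hρ0 hρR hx))
      refine ⟨fun x hx => (contDiffAt_rescaled (ne_zero_of_one_le_norm (le_of_lt hx))
        (hcd b x (le_of_lt hx))).contDiffWithinAt, fun x hx => ?_⟩
      have hx1 : 1 ≤ ‖x‖ := le_of_lt hx
      have hx0 := ne_zero_of_one_le_norm hx1
      have hvb : ∀ b, |v ρ b x| ≤ C₁ / ρ := fun b => by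
        rw [le_div_iff₀ hρ0]
        have := (hρ b x hx1).trans (hle₁ b)
        rw [abs_mul, abs_of_pos hρ0] at this
        linarith
      refine ⟨(hvb b).trans (by gcongr; rw [hC]; linarith), ?_⟩
      set z : Option (Fin 3) → Fin 3 → ℝ := fun b i => pd i (v ρ b) x with hz
      have hgrad : (fun b i => pd i (unknown u Y b) (ρ • x))
          = (ρ ^ 2)⁻¹ • (leadingGrad α x + z) := by
        ext b i
        simp only [hz, hvdef, Pi.smul_apply, Pi.add_apply, smul_eq_mul,
          pd_rescaled hx0 (hcd b x hx1), leadingGrad]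
        field_simp
        ring
      -- The powers of `ρ` cancel: `ρ·ρ³` from rescaling against `(ρ⁻²)²` from the quadratic source.
      have hlap : ρ * lap (v ρ b) x = weight u b (ρ • x) * source (leadingGrad α x + z) b := by
        simp only [hvdef]
        rw [lap_rescaled hx0 (hcd b x hx1),
          h.lap_unknown hV (smul_mem_exterior hρ0 hρR hx1), hgrad, source_scale]
        field_simp
      have hu1 : |u (ρ • x) - 1| ≤ (C₁ + L) / ρ := by
        have h1 : ρ * (u (ρ • x) - 1) = v ρ none x + α none * ‖x‖⁻¹ := by
          simp [hvdef, rescaled, unknown, limitValue]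
        have h2 : |ρ * (u (ρ • x) - 1)| ≤ C₁ + L := by
          rw [h1]
          have h3 : |v ρ none x| ≤ C₁ := (hvb none).trans (div_le_self hC₁0 hρ1)
          have h4 : |α none * ‖x‖⁻¹| ≤ L := by
            rw [abs_mul, abs_of_pos (by positivity : 0 < ‖x‖⁻¹)]
            calc |α none| * ‖x‖⁻¹ ≤ |α none| * 1 := by
                  gcongr; exact inv_le_one_of_one_le₀ hx1
              _ ≤ L := by
                  rw [mul_one]
                  exact Finset.single_le_sum (f := fun a => |α a|) (fun _ _ => abs_nonneg _)
                    (Finset.mem_univ none)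
          exact (abs_add_le _ _).trans (add_le_add h3 h4)
        rw [abs_mul, abs_of_pos hρ0] at h2
        rw [le_div_iff₀ hρ0]
        linarith
      have huhalf : 1 / 2 ≤ u (ρ • x) := by
        have := (abs_le.1 hu1).1
        linarith
      have hw : |weight u b (ρ • x) - 1| ≤ 2 * ((C₁ + L) / ρ) := by
        cases b with
        | none => exact hu1.trans (by linarith [abs_nonneg (u (ρ • x) - 1)])
        | some i =>
          have hu0 : 0 < u (ρ • x) := by linarith
          have e : (u (ρ • x))⁻¹ - 1 = -(u (ρ • x) - 1) * (u (ρ • x))⁻¹ := by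
            field_simp
            ring
          simp only [weight]
          rw [e, abs_mul, abs_neg, abs_of_pos (inv_pos.2 hu0)]
          have : (u (ρ • x))⁻¹ ≤ 2 := by
            rw [inv_le_comm₀ hu0 two_pos]; linarith
          calc |u (ρ • x) - 1| * (u (ρ • x))⁻¹ ≤ ((C₁ + L) / ρ) * 2 :=
                mul_le_mul hu1 this (inv_pos.2 hu0).le ((abs_nonneg _).trans hu1)
            _ = _ := by ring
      have hw2 : |weight u b (ρ • x)| ≤ 2 := by
        have := abs_sub_abs_le_abs_sub (weight u b (ρ • x)) 1
        rw [abs_one] at this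
        linarith
      have hzS : ‖z‖ ≤ √(gradSq (v ρ) x) := norm_grad_le (v ρ) x
      have hdiff : |source (leadingGrad α x + z) b - source (leadingGrad α x) b|
          ≤ C₂ * (L * √(gradSq (v ρ) x) + gradSq (v ρ) x) := by
        refine (hCs b (leadingGrad α x) z).trans ?_
        have h1 : ‖z‖ ^ 2 ≤ gradSq (v ρ) x := by
          rw [← Real.sq_sqrt (gradSq_nonneg (v ρ) x)]
          gcongr
        have h2 := norm_leadingGrad_le α hx1
        have h3 := hle₂ b
        gcongr
      set S := gradSq (v ρ) x with hS
      have hS0 : 0 ≤ S := gradSq_nonneg _ _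
      have hδ0 : 0 ≤ 2 * ((C₁ + L) / ρ) := by positivity
      rw [hlap]
      calc |weight u b (ρ • x) * source (leadingGrad α x + z) b - source (leadingGrad α x) b|
          = |weight u b (ρ • x) * (source (leadingGrad α x + z) b - source (leadingGrad α x) b)
            + (weight u b (ρ • x) - 1) * source (leadingGrad α x) b| := by ring_nf
        _ ≤ |weight u b (ρ • x)| * |source (leadingGrad α x + z) b - source (leadingGrad α x) b|
            + |weight u b (ρ • x) - 1| * |source (leadingGrad α x) b| := by
            rw [← abs_mul, ← abs_mul]; exact abs_add_le _ _
        _ ≤ 2 * (C₂ * (L * √S + S)) + 2 * ((C₁ + L) / ρ) * (C₂ * L ^ 2) := by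
            have := hsrc b x hx1
            gcongr
        _ = (2 * C₂ * L) * √S + (2 * C₂) * S + (C₂ * L ^ 2) * (2 * ((C₁ + L) / ρ)) := by ring
        _ ≤ C * √S + C * S + C * (2 * ((C₁ + L) / ρ)) := by
            have e1 : 0 ≤ C₂ * L := by positivity
            have e2 : 0 ≤ C₂ * L ^ 2 := by positivity
            gcongr <;> rw [hC] <;> linarith
        _ = _ := by ring) a
  have hlim' := (hE a).tendsto_integral (h.contDiffOn_unknown a) (continuous_lap hφ)
    (tsupport_lap_subset.trans hs)
  -- The same integrals converge to the left side by the uniform expansion and to the right side by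
  -- the equation.
  exact tendsto_nhds_unique hlim' hlim

/-- Both `F a` and the particular solution satisfy the same distributional equation, so their
difference is weakly harmonic and rigidity applies. -/
theorem HarmonicAsymptotics.exists_linear (h : HarmonicAsymptotics R g k u Y)
    (hV : VacuumConstraint g k (exterior R))
    (hE : ∀ a, HasExpansion (unknown u Y a) (limitValue a) (leading A B a) (F a))
    (a : Option (Fin 3)) :
    ∃ c : Fin 3 → ℝ, ∀ X : E3, ‖X‖ = 1 → F a X - particular A B a X = ∑ i, c i * X i := by
  have hcF := (hE a).continuousOn (h.contDiffOn_unknown a)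
  have hcP : ContinuousOn (particular A B a) (sphere 0 1) :=
    (continuous_particular A B a).continuousOn
  refine WeaklyHarmonic.exists_linear (h := fun X => F a X - particular A B a X) ?_ (hcF.sub hcP)
  intro φ hφ hs
  have hls : tsupport (lap φ) ⊆ shell := tsupport_lap_subset.trans hs
  have hI : ∀ f : E3 → ℝ, ContinuousOn f (sphere 0 1) →
      Integrable fun x : E3 => f (‖x‖⁻¹ • x) / ‖x‖ ^ 2 * lap φ x := by
    intro f hf
    have := integrable_mul_of_tsupport isOpen_compl_singleton (continuous_lap hφ)
      (hasCompactSupport_of_shell hls) (fun x hx => ne_zero_of_mem_shell (hls hx))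
      ((continuousOn_comp_direction hf).mul (continuousOn_norm_inv_pow 2))
    simpa only [div_eq_mul_inv, mul_comm, Pi.mul_apply] using this
  simp only [sub_div, sub_mul]
  rw [integral_sub (hI _ hcF) (hI _ hcP), h.integral_second_order hV hE a hφ hs,
    integral_particular A B a hφ hs, sub_self]

end Main

end InitialData

theorem mainTheorem3 (R : ℝ) (g k : InitialData.Tensor2)
    (u : InitialData.E3 → ℝ) (Y : Fin 3 → InitialData.E3 → ℝ)
    (hHA : InitialData.HarmonicAsymptotics R g k u Y)
    (hVac : InitialData.VacuumConstraint g k (InitialData.exterior R))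
    (A : ℝ) (B : Fin 3 → ℝ) (u₂ : InitialData.E3 → ℝ) (Y₂ : Fin 3 → InitialData.E3 → ℝ)
    (hu : InitialData.HasExpansion u 1 A u₂)
    (hY : ∀ i, InitialData.HasExpansion (Y i) 0 (B i) (Y₂ i)) :
    ∃ (c : Fin 3 → ℝ) (d : Fin 3 → Fin 3 → ℝ),
      ∀ X : InitialData.E3, ‖X‖ = 1 →
        u₂ X = ∑ i, c i * X i - 9 / 64 * ∑ i, B i ^ 2
          + 1 / 64 * ∑ i, ∑ j, B i * B j * X i * X j ∧
        ∀ i, Y₂ i X = ∑ j, d i j * X j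
          + A * (-(5 / 2) * B i + 1 / 2 * (∑ l, B l * X l) * X i) := by
  have hE : ∀ a, InitialData.HasExpansion (InitialData.unknown u Y a) (InitialData.limitValue a)
      (InitialData.leading A B a) (InitialData.unknown u₂ Y₂ a) := by
    intro a
    cases a with
    | none => exact hu
    | some i => exact hY i
  choose c hc using hHA.exists_linear hVac hE
  refine ⟨c none, fun i => c (some i), fun X hX => ⟨?_, fun i => ?_⟩⟩
  · have h := hc none X hX
    have h2 : ∑ i, ∑ j, B i * B j * X i * X j = (∑ i, B i * X i) ^ 2 := by
      simp only [Fin.sum_univ_three]; ring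
    simp only [InitialData.unknown, InitialData.particular] at h
    rw [h2]
    linarith
  · have h := hc (some i) X hX
    simp only [InitialData.unknown, InitialData.particular] at h
    linarith
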